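/- Let $n\ge 1$ be an integer, $s\in(0,1)$, $p>1$ with $n>sp$, and let $\Omega\subset\mathbb R^n$ be a bounded open set. For measurable $u:\mathbb R^n\to\mathbb R$, $x_0\in\mathbb R^n$ and $R>0$ put $$[u]_{W^{s,p}(S)}:=\Big(\int_S\int_S\frac{|u(x)-u(y)|^p}{|x-y|^{n+sp}}\,dx\,dy\Big)^{1/p},\qquad \mathrm{Tail}_{s,p}(u;x_0,R):=\Big(R^{sp}\int_{\mathbb R^n\setminus B_R(x_0)}\frac{|u(x)|^{p-1}}{|x-x_0|^{n+sp}}\,dx\Big)^{\frac1{p-1}},$$ and $\overline{\mathrm{Tail}}_{s,p}(u;x_0,R):=R^{-\frac{sp}{p-1}}\,\mathrm{Tail}_{s,p}(u;x_0,R)$. Write $v_+=\max\{v,0\}$ and $v_-=\max\{-v,0\}$. For $d,\lambda\ge0$ and $H\ge1$, the class $\mathrm{DG}_\pm(\Omega;d,H,\lambda)$ consists of the measurable functions $u:\mathbb R^n\to\mathbb R$ with $\int_{\mathbb R^n}\frac{|u(x)|^{p-1}}{(1+|x|)^{n+sp}}\,dx<\infty$, $u\in L^p(\Omega)$ and $[u]_{W^{s,p}(\Omega)}<\infty$,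 such that, for every $x_0\in\Omega$, $0<r<R<\mathrm{dist}(x_0,\partial\Omega)$ and $k\in\mathbb R$, $$\begin{aligned}&[(u-k)_\pm]_{W^{s,p}(B_r(x_0))}^p+\int_{B_r(x_0)}(u(x)-k)_\pm\Big\{\int_{\mathbb R^n}\frac{(u(y)-k)_\mp^{p-1}}{|x-y|^{n+sp}}\,dy\Big\}dx\\ &\quad\le H\Big\{R^\lambda d^p\,|A^\pm|+\frac{R^{(1-s)p}}{(R-r)^p}\|(u-k)_\pm\|_{L^p(B_R(x_0))}^p\\ &\qquad\quad+\frac{R^{n+sp}}{(R-r)^{n+sp}}\|(u-k)_\pm\|_{L^1(B_R(x_0))}\,\overline{\mathrm{Tail}}_{s,p}((u-k)_\pm;x_0,r)^{p-1}\Big\},\end{aligned}$$ where $A^+=B_R(x_0)\cap\{u>k\}$ and $A^-=B_R(x_0)\cap\{u<k\}$. Put $\mathrm{DG}(\Omega;d,H,\lambda):=\mathrm{DG}_+(\Omega;d,H,\lambda)\cap\mathrm{DG}_-(\Omega;d,H,\lambda)$. **Theorem (Hölder continuity of functions in DG).** There exist $\alpha\in(0,1)$ and $C\ge1$, depending only on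 $n,s,p,H,\lambda$, such that every $u\in\mathrm{DG}(\Omega;d,H,\lambda)$, after modification on a subset of $\Omega$ of measure zero, belongs to $C^\alpha_{\mathrm{loc}}(\Omega)$ (that is, $u$ is $\alpha$-Hölder continuous on every compact subset of $\Omega$) and satisfies $$[u]_{C^\alpha(B_R(x_0))}\le\frac{C}{R^\alpha}\Big(\|u\|_{L^\infty(B_{2R}(x_0))}+\mathrm{Tail}_{s,p}(u;x_0,2R)+R^{\frac{\lambda+sp}{p}}d\Big)$$ for every $x_0\in\Omega$ and $0<R<\mathrm{dist}(x_0,\partial\Omega)/2$, where $[u]_{C^\alpha(S)}:=\sup_{x\ne y\in S}|u(x)-u(y)|/|x-y|^\alpha$. -/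

import Mathlib

open MeasureTheory Set Metric
open scoped ENNReal

/-- Euclidean space of dimension `n`. -/
abbrev FracDG.E (n : ℕ) : Type := EuclideanSpace ℝ (Fin n)

namespace FracDG

noncomputable section

/-- The Gagliardo seminorm `[u]_{W^{s,p}(S)}`, with values in `[0, ∞]`. (The real quotient is `0`
on the diagonal, a null set.) -/
def gagliardoSeminorm {n : ℕ} (s p : ℝ) (u : E n → ℝ) (S : Set (E n)) : ℝ≥0∞ :=
  (∫⁻ x in S, ∫⁻ y in S,
    ENNReal.ofReal (|u x - u y| ^ p / ‖x - y‖ ^ ((n : ℝ) + s * p))) ^ (1 / p)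

/-- The restriction of `u` to `Ω` lies in the fractional Sobolev space `W^{s,p}(Ω)`. -/
def MemW {n : ℕ} (s p : ℝ) (u : E n → ℝ) (Ω : Set (E n)) : Prop :=
  MemLp u (ENNReal.ofReal p) (volume.restrict Ω) ∧ gagliardoSeminorm s p u Ω < ∞

/-- The weighted Lebesgue space `L^{p-1}_s(ℝⁿ)`; "measurable" is Lebesgue measurable. -/
def MemWeightedL {n : ℕ} (s p : ℝ) (u : E n → ℝ) : Prop :=
  AEMeasurable u volume ∧
    ∫⁻ x, ENNReal.ofReal (|u x| ^ (p - 1) / (1 + ‖x‖) ^ ((n : ℝ) + s * p)) < ∞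

/-- `Tail_{s,p}(u; x₀, R)`. -/
def tail {n : ℕ} (s p : ℝ) (u : E n → ℝ) (x₀ : E n) (R : ℝ) : ℝ≥0∞ :=
  (ENNReal.ofReal (R ^ (s * p)) *
    ∫⁻ x in (ball x₀ R)ᶜ,
      ENNReal.ofReal (|u x| ^ (p - 1) / ‖x - x₀‖ ^ ((n : ℝ) + s * p))) ^ (1 / (p - 1))

/-- The rescaled tail `R^{-sp/(p-1)} Tail_{s,p}(u; x₀, R)`. -/
def tailBar {n : ℕ} (s p : ℝ) (u : E n → ℝ) (x₀ : E n) (R : ℝ) : ℝ≥0∞ :=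
  ENNReal.ofReal (R ^ (-(s * p / (p - 1)))) * tail s p u x₀ R

/-- The strong Caccioppoli inequality on `B_r(x₀) ⊂ B_R(x₀)`. It is used with
`w = (u - k)_±`, `v = (u - k)_∓` and `A = A^±(k)`. -/
def StrongCaccioppoli {n : ℕ} (s p d H lam : ℝ) (w v : E n → ℝ) (A : Set (E n))
    (x₀ : E n) (r R : ℝ) : Prop :=
  gagliardoSeminorm s p w (ball x₀ r) ^ p
      + ∫⁻ x in ball x₀ r, ENNReal.ofReal (w x) *
          ∫⁻ y, ENNReal.ofReal (v y ^ (p - 1) / ‖x - y‖ ^ ((n : ℝ) + s * p))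
    ≤ ENNReal.ofReal H *
      (ENNReal.ofReal (R ^ lam * d ^ p) * volume (A ∩ ball x₀ R)
        + ENNReal.ofReal (R ^ ((1 - s) * p) / (R - r) ^ p)
            * eLpNorm w (ENNReal.ofReal p) (volume.restrict (ball x₀ R)) ^ p
        + ENNReal.ofReal (R ^ ((n : ℝ) + s * p) / (R - r) ^ ((n : ℝ) + s * p))
            * eLpNorm w 1 (volume.restrict (ball x₀ R)) * tailBar s p w x₀ r ^ (p - 1))

/-- The class `DG^{s,p}_+(Ω; d, H, λ)`. -/
def DGPlus {n : ℕ} (s p d H lam : ℝ) (Ω : Set (E n)) : Set (E n → ℝ) :=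
  {u | MemWeightedL s p u ∧ MemW s p u Ω ∧
    ∀ x₀ ∈ Ω, ∀ r R : ℝ, 0 < r → r < R → R < infDist x₀ (frontier Ω) → ∀ k : ℝ,
      StrongCaccioppoli s p d H lam (fun x => (u x - k)⁺) (fun x => (u x - k)⁻)
        {x | k < u x} x₀ r R}

/-- The class `DG^{s,p}_-(Ω; d, H, λ)`. -/
def DGMinus {n : ℕ} (s p d H lam : ℝ) (Ω : Set (E n)) : Set (E n → ℝ) :=
  {u | MemWeightedL s p u ∧ MemW s p u Ω ∧
    ∀ x₀ ∈ Ω, ∀ r R : ℝ, 0 < r → r < R → R < infDist x₀ (frontier Ω) → ∀ k : ℝ,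
      StrongCaccioppoli s p d H lam (fun x => (u x - k)⁻) (fun x => (u x - k)⁺)
        {x | u x < k} x₀ r R}

/-- The strong fractional De Giorgi class `DG^{s,p}(Ω; d, H, λ)`. -/
def DG {n : ℕ} (s p d H lam : ℝ) (Ω : Set (E n)) : Set (E n → ℝ) :=
  DGPlus s p d H lam Ω ∩ DGMinus s p d H lam Ω

/-- The Hölder seminorm `[u]_{C^α(S)}`, with values in `[0, ∞]` (the real quotient is `0` for
`x = y`, so those pairs do not contribute). -/
def holderSeminorm {n : ℕ} (α : ℝ) (u : E n → ℝ) (S : Set (E n)) : ℝ≥0∞ :=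
  ⨆ x ∈ S, ⨆ y ∈ S, ENNReal.ofReal (|u x - u y| / ‖x - y‖ ^ α)

/-- `u ∈ C^α_loc(Ω)`: finite Hölder seminorm on each compact subset of `Ω` (for `α > 0` this
entails continuity, hence boundedness, on each such subset). -/
def LocHolder {n : ℕ} (α : ℝ) (u : E n → ℝ) (Ω : Set (E n)) : Prop :=
  ∀ K ⊆ Ω, IsCompact K → holderSeminorm α u K < ∞

end

end FracDG

/-!
The radii and levels of De Giorgi's iteration, combined with a fractional Faber–Krahn inequality for
functions supported in a small part of a ball, turn the Caccioppoli inequality into a bound for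
`u` from above as soon as the excess of `u` over some level is small. Applied at level `0`, this
gives local boundedness.

For the oscillation, let `m ≤ u ≤ M` on a ball, with `M - m = ω`. After replacing `u` by `-u` if
necessary, the set where `u` lies below the mean value `(m + M) / 2` fills at least half of the
ball. The interaction term on the left of the Caccioppoli inequality, integrated against this set,
makes the excess over a level slightly below `M` small, so `M` can be lowered by a fixed fraction of
`ω` on a smaller ball. The tails stay controlled because `u` leaves `[m, M]` only by the amount
`ω ((4 |x - x₀| / ρ)^α - 1)`, whose tail tends to zero with `α`. Iterating on balls of radii
`4^{-j}` gives oscillations `4^{-α j}`, that is, Hölder continuity.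
-/

namespace FracDG

noncomputable section

variable {n : ℕ} {s p d H lam : ℝ}

/-- The double integral `[w]_{W^{s,p}(S)}^p`. -/
def gagliardoEnergy (s p : ℝ) (w : E n → ℝ) (S : Set (E n)) : ℝ≥0∞ :=
  ∫⁻ x in S, ∫⁻ y in S, ENNReal.ofReal (|w x - w y| ^ p / ‖x - y‖ ^ ((n : ℝ) + s * p))

/-- The unnormalized tail, that is `Tail_{s,p}(w; x₀, r)^{p-1}` without the factor `r^{sp}`. -/
def tailIntegral (s p : ℝ) (w : E n → ℝ) (x₀ : E n) (r : ℝ) : ℝ≥0∞ :=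
  ∫⁻ x in (ball x₀ r)ᶜ, ENNReal.ofReal (|w x| ^ (p - 1) / ‖x - x₀‖ ^ ((n : ℝ) + s * p))

/-- The nonlocal interaction of `w` on `S` with `v` on the whole space, the second term of the
strong Caccioppoli inequality. -/
def interaction (s p : ℝ) (w v : E n → ℝ) (S : Set (E n)) : ℝ≥0∞ :=
  ∫⁻ x in S, ENNReal.ofReal (w x) *
    ∫⁻ y, ENNReal.ofReal (v y ^ (p - 1) / ‖x - y‖ ^ ((n : ℝ) + s * p))

/-- The excess `∫ (f - k)_+^a dμ` of `f` over the level `k`, the quantity iterated by De Giorgi. -/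
def excess {X : Type*} [MeasurableSpace X] (a : ℝ) (f : X → ℝ) (k : ℝ) (μ : Measure X) : ℝ≥0∞ :=
  ∫⁻ x, ENNReal.ofReal ((f x - k)⁺ ^ a) ∂μ

/-- The strong Caccioppoli inequalities for all superlevel sets of `f` on all balls centred at `x₀`
of radius at most `ρ`, with the norms written as integrals. The inequalities for the sublevel sets
of `f` are those for the superlevel sets of `-f`. -/
def SuperlevelCaccioppoli (s p d H lam : ℝ) (f : E n → ℝ) (x₀ : E n) (ρ : ℝ) : Prop :=
  ∀ r R : ℝ, 0 < r → r < R → R ≤ ρ → ∀ k : ℝ,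
    gagliardoEnergy s p (fun x => (f x - k)⁺) (ball x₀ r)
      + interaction s p (fun x => (f x - k)⁺) (fun x => (f x - k)⁻) (ball x₀ r)
    ≤ ENNReal.ofReal H *
      (ENNReal.ofReal (R ^ lam * d ^ p) * volume ({x | k < f x} ∩ ball x₀ R)
        + ENNReal.ofReal (R ^ ((1 - s) * p) / (R - r) ^ p)
            * excess p f k (volume.restrict (ball x₀ R))
        + ENNReal.ofReal (R ^ ((n : ℝ) + s * p) / (R - r) ^ ((n : ℝ) + s * p))
            * excess 1 f k (volume.restrict (ball x₀ R))
            * tailIntegral s p (fun x => (f x - k)⁺) x₀ r)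

theorem gagliardoSeminorm_rpow (hp : p ≠ 0) (w : E n → ℝ) (S : Set (E n)) :
    gagliardoSeminorm s p w S ^ p = gagliardoEnergy s p w S := by
  rw [gagliardoSeminorm, ← ENNReal.rpow_mul, one_div_mul_cancel hp, ENNReal.rpow_one]
  rfl

theorem tail_rpow (hp : p ≠ 1) (w : E n → ℝ) (x₀ : E n) (r : ℝ) :
    tail s p w x₀ r ^ (p - 1) = ENNReal.ofReal (r ^ (s * p)) * tailIntegral s p w x₀ r := by
  rw [tail, ← ENNReal.rpow_mul, one_div_mul_cancel (sub_ne_zero.2 hp), ENNReal.rpow_one]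
  rfl

theorem tailBar_rpow (hp : 1 < p) (w : E n → ℝ) (x₀ : E n) {r : ℝ} (hr : 0 < r) :
    tailBar s p w x₀ r ^ (p - 1) = tailIntegral s p w x₀ r := by
  have hp1 : 0 < p - 1 := by linarith
  have hscale : (r ^ (-(s * p / (p - 1)))) ^ (p - 1) * r ^ (s * p) = 1 := by
    rw [← Real.rpow_mul hr.le, ← Real.rpow_add hr, neg_mul, div_mul_cancel₀ _ hp1.ne',
      neg_add_cancel, Real.rpow_zero]
  rw [tailBar, ENNReal.mul_rpow_of_nonneg _ _ hp1.le, tail_rpow hp.ne',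
    ENNReal.ofReal_rpow_of_pos (by positivity), ← mul_assoc, ← ENNReal.ofReal_mul (by positivity),
    hscale, ENNReal.ofReal_one, one_mul]

theorem eLpNorm_ofReal_rpow_of_nonneg {X : Type*} [MeasurableSpace X] {μ : Measure X} {a : ℝ}
    (ha : 0 < a) {w : X → ℝ} (hw : ∀ x, 0 ≤ w x) :
    eLpNorm w (ENNReal.ofReal a) μ ^ a = ∫⁻ x, ENNReal.ofReal (w x ^ a) ∂μ := by
  lift a to NNReal using ha.le
  rw [ENNReal.ofReal_coe_nnreal, eLpNorm_nnreal_pow_eq_lintegral (by exact_mod_cast ha.ne')]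
  refine lintegral_congr fun x => ?_
  rw [Real.enorm_of_nonneg (hw x), ENNReal.ofReal_rpow_of_nonneg (hw x) ha.le]

theorem eLpNorm_one_of_nonneg {X : Type*} [MeasurableSpace X] {μ : Measure X} {w : X → ℝ}
    (hw : ∀ x, 0 ≤ w x) : eLpNorm w 1 μ = ∫⁻ x, ENNReal.ofReal (w x ^ (1 : ℝ)) ∂μ := by
  simpa using eLpNorm_ofReal_rpow_of_nonneg (μ := μ) one_pos hw

theorem superlevelCaccioppoli_of_mem_DGPlus (hp : 1 < p) {Ω : Set (E n)} {u : E n → ℝ}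
    (hu : u ∈ DGPlus s p d H lam Ω) {x₀ : E n} (hx₀ : x₀ ∈ Ω) {ρ : ℝ}
    (hρ : ρ < infDist x₀ (frontier Ω)) : SuperlevelCaccioppoli s p d H lam u x₀ ρ := by
  intro r R hr hrR hR k
  have h := hu.2.2 x₀ hx₀ r R hr hrR (hR.trans_lt hρ) k
  rwa [StrongCaccioppoli, gagliardoSeminorm_rpow (by linarith), tailBar_rpow hp _ _ hr,
    eLpNorm_ofReal_rpow_of_nonneg (by linarith) (fun x => posPart_nonneg _),
    eLpNorm_one_of_nonneg (fun x => posPart_nonneg _)] at h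

theorem superlevelCaccioppoli_neg_of_mem_DGMinus (hp : 1 < p) {Ω : Set (E n)} {u : E n → ℝ}
    (hu : u ∈ DGMinus s p d H lam Ω) {x₀ : E n} (hx₀ : x₀ ∈ Ω) {ρ : ℝ}
    (hρ : ρ < infDist x₀ (frontier Ω)) :
    SuperlevelCaccioppoli s p d H lam (fun x => -u x) x₀ ρ := by
  intro r R hr hrR hR k
  have h := hu.2.2 x₀ hx₀ r R hr hrR (hR.trans_lt hρ) (-k)
  rw [StrongCaccioppoli, gagliardoSeminorm_rpow (by linarith), tailBar_rpow hp _ _ hr,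
    eLpNorm_ofReal_rpow_of_nonneg (by linarith) (fun x => negPart_nonneg _),
    eLpNorm_one_of_nonneg (fun x => negPart_nonneg _)] at h
  have hneg (x : E n) : -u x - k = -(u x - -k) := by ring
  have hset : {x | u x < -k} = {x | k < -u x} := by
    ext x; exact lt_neg (a := u x)
  simpa only [excess, interaction, hneg, posPart_neg, negPart_neg, ← hset] using h

theorem gagliardoEnergy_congr {w w' : E n → ℝ} (h : w =ᵐ[volume] w') (S : Set (E n)) :
    gagliardoEnergy s p w S = gagliardoEnergy s p w' S := by
  have h' := ae_restrict_of_ae (s := S) h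
  refine lintegral_congr_ae ?_
  filter_upwards [h'] with x hx
  refine lintegral_congr_ae ?_
  filter_upwards [h'] with y hy
  rw [hx, hy]

theorem tailIntegral_congr {w w' : E n → ℝ} (h : w =ᵐ[volume] w') (x₀ : E n) (r : ℝ) :
    tailIntegral s p w x₀ r = tailIntegral s p w' x₀ r := by
  refine lintegral_congr_ae ?_
  filter_upwards [ae_restrict_of_ae h] with x hx
  rw [hx]

theorem interaction_congr {w w' v v' : E n → ℝ} (hw : w =ᵐ[volume] w') (hv : v =ᵐ[volume] v')
    (S : Set (E n)) : interaction s p w v S = interaction s p w' v' S := by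
  refine lintegral_congr_ae ?_
  filter_upwards [ae_restrict_of_ae hw] with x hx
  rw [hx]
  congr 1
  refine lintegral_congr_ae ?_
  filter_upwards [hv] with y hy
  rw [hy]

theorem SuperlevelCaccioppoli.congr {f g : E n → ℝ} {x₀ : E n} {ρ : ℝ}
    (hf : SuperlevelCaccioppoli s p d H lam f x₀ ρ) (h : f =ᵐ[volume] g) :
    SuperlevelCaccioppoli s p d H lam g x₀ ρ := by
  intro r R hr hrR hR k
  have hpos : (fun x => (f x - k)⁺) =ᵐ[volume] fun x => (g x - k)⁺ :=
    h.fun_comp fun t => (t - k)⁺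
  have hneg : (fun x => (f x - k)⁻) =ᵐ[volume] fun x => (g x - k)⁻ :=
    h.fun_comp fun t => (t - k)⁻
  have hexcess (a : ℝ) : excess a f k (volume.restrict (ball x₀ R))
      = excess a g k (volume.restrict (ball x₀ R)) :=
    lintegral_congr_ae (ae_restrict_of_ae (h.fun_comp fun t => ENNReal.ofReal ((t - k)⁺ ^ a)))
  have hset : volume ({x | k < f x} ∩ ball x₀ R) = volume ({x | k < g x} ∩ ball x₀ R) :=
    measure_congr ((h.fun_comp fun t => k < t).inter .rfl)
  have hfk := hf r R hr hrR hR k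
  rwa [gagliardoEnergy_congr hpos, interaction_congr hpos hneg, tailIntegral_congr hpos,
    hexcess, hexcess, hset] at hfk

theorem SuperlevelCaccioppoli.mono {f : E n → ℝ} {x₀ : E n} {ρ ρ' : ℝ}
    (hf : SuperlevelCaccioppoli s p d H lam f x₀ ρ) (h : ρ' ≤ ρ) :
    SuperlevelCaccioppoli s p d H lam f x₀ ρ' :=
  fun r R hr hrR hR k => hf r R hr hrR (hR.trans h) k

theorem tailIntegral_mono (hp : 1 ≤ p) {w w' : E n → ℝ} (h : ∀ x, |w x| ≤ |w' x|) (x₀ : E n)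
    {r r' : ℝ} (hr : r' ≤ r) : tailIntegral s p w x₀ r ≤ tailIntegral s p w' x₀ r' := by
  refine (lintegral_mono_set (compl_subset_compl.2 (ball_subset_ball hr))).trans ?_
  refine lintegral_mono fun x => ENNReal.ofReal_le_ofReal ?_
  have hrpow := Real.rpow_le_rpow (abs_nonneg _) (h x) (sub_nonneg.2 hp)
  gcongr

theorem tailIntegral_posPart_sub_anti (hp : 1 ≤ p) (f : E n → ℝ) {l l' : ℝ} (hl : l ≤ l')
    (x₀ : E n) {r r' : ℝ} (hr : r' ≤ r) :
    tailIntegral s p (fun x => (f x - l')⁺) x₀ r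
      ≤ tailIntegral s p (fun x => (f x - l)⁺) x₀ r' := by
  refine tailIntegral_mono hp (fun x => ?_) x₀ hr
  rw [abs_of_nonneg (posPart_nonneg _), abs_of_nonneg (posPart_nonneg _)]
  exact posPart_mono (by linarith)

section Excess

variable {X : Type*} [MeasurableSpace X] {μ : Measure X} {a b : ℝ} {f : X → ℝ} {l l' h : ℝ}

theorem excess_anti (ha : 0 ≤ a) (hl : l ≤ l') : excess a f l' μ ≤ excess a f l μ :=
  lintegral_mono fun _ => ENNReal.ofReal_le_ofReal <|
    Real.rpow_le_rpow (posPart_nonneg _) (posPart_mono (by linarith)) ha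

theorem excess_mono_measure {ν : Measure X} (hμ : μ ≤ ν) : excess a f l μ ≤ excess a f l ν :=
  lintegral_mono' hμ le_rfl

/-- On `{t > l'}` the quotient `(t - l) / h` is at least one, so it may be raised to the power
`b - a`. -/
theorem posPart_rpow_le_of_add_le (ha : 0 < a) (hab : a ≤ b) (hh : 0 < h) (hl : l + h ≤ l')
    (t : ℝ) : (t - l')⁺ ^ a ≤ (1 / h) ^ (b - a) * (t - l)⁺ ^ b := by
  rcases le_total t l' with ht | ht
  · rw [posPart_eq_zero.2 (by linarith), Real.zero_rpow ha.ne']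
    have := posPart_nonneg (t - l)
    positivity
  have hlt : 0 < t - l := by linarith
  have hquot : 1 ≤ (1 / h * (t - l)) ^ (b - a) := by
    refine Real.one_le_rpow ?_ (by linarith)
    rw [one_div_mul_eq_div, one_le_div hh]
    linarith
  rw [posPart_eq_self.2 (by linarith : 0 ≤ t - l'), posPart_eq_self.2 hlt.le]
  calc (t - l') ^ a ≤ 1 * (t - l) ^ a := by
        rw [one_mul]; exact Real.rpow_le_rpow (by linarith) (by linarith) ha.le
    _ ≤ (1 / h * (t - l)) ^ (b - a) * (t - l) ^ a := by gcongr
    _ = (1 / h) ^ (b - a) * (t - l) ^ b := by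
        rw [Real.mul_rpow (by positivity) hlt.le, mul_assoc, ← Real.rpow_add hlt, sub_add_cancel]

theorem excess_le_of_add_le (ha : 0 < a) (hab : a ≤ b) (hh : 0 < h) (hl : l + h ≤ l') :
    excess a f l' μ ≤ ENNReal.ofReal ((1 / h) ^ (b - a)) * excess b f l μ := by
  rw [excess, excess, ← lintegral_const_mul' _ _ ENNReal.ofReal_ne_top]
  refine lintegral_mono fun x => ?_
  rw [← ENNReal.ofReal_mul (by positivity)]
  exact ENNReal.ofReal_le_ofReal (posPart_rpow_le_of_add_le ha hab hh hl _)

theorem measure_superlevel_le (ha : 0 ≤ a) (hf : Measurable f) (hh : 0 < h) (hl : l + h ≤ l') :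
    μ {x | l' < f x} ≤ ENNReal.ofReal ((1 / h) ^ a) * excess a f l μ := by
  have hsub : {x | l' < f x} ⊆ {x | ENNReal.ofReal (h ^ a) ≤ ENNReal.ofReal ((f x - l)⁺ ^ a)} := by
    intro x hx
    have hx' : l' < f x := hx
    exact ENNReal.ofReal_le_ofReal
      (Real.rpow_le_rpow hh.le ((by linarith : h ≤ f x - l).trans (le_posPart _)) ha)
  have hone : ENNReal.ofReal ((1 / h) ^ a) * ENNReal.ofReal (h ^ a) = 1 := by
    rw [← ENNReal.ofReal_mul (by positivity), ← Real.mul_rpow (by positivity) hh.le,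
      one_div_mul_cancel hh.ne', Real.one_rpow, ENNReal.ofReal_one]
  calc μ {x | l' < f x}
      = ENNReal.ofReal ((1 / h) ^ a) * (ENNReal.ofReal (h ^ a) * μ {x | l' < f x}) := by
        rw [← mul_assoc, hone, one_mul]
    _ ≤ ENNReal.ofReal ((1 / h) ^ a) * excess a f l μ := by
        gcongr
        exact (mul_le_mul_right (measure_mono hsub) _).trans
          (mul_meas_ge_le_lintegral (by fun_prop) _)

theorem ae_le_of_excess_eq_zero (hf : Measurable f) (h : excess a f l μ = 0) :
    ∀ᵐ x ∂μ, f x ≤ l := by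
  rw [excess, lintegral_eq_zero_iff (by fun_prop)] at h
  filter_upwards [h] with x hx
  by_contra! hlt
  have : 0 < (f x - l)⁺ := posPart_pos_iff.2 (by linarith)
  exact (ENNReal.ofReal_pos.2 (Real.rpow_pos_of_pos this a)).ne' hx

end Excess

/-! ### A fractional Faber–Krahn inequality -/

/-- The volume of the unit ball of `ℝⁿ`. -/
def unitBallVolume (n : ℕ) : ℝ := volume.real (ball (0 : E n) 1)

theorem unitBallVolume_pos (n : ℕ) : 0 < unitBallVolume n :=
  ENNReal.toReal_pos (measure_ball_pos _ _ one_pos).ne' measure_ball_lt_top.ne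

theorem volume_ball_eq (x : E n) {r : ℝ} (hr : 0 < r) :
    volume (ball x r) = ENNReal.ofReal (unitBallVolume n * r ^ n) := by
  rw [Measure.addHaar_ball_of_pos _ _ hr, finrank_euclideanSpace_fin, unitBallVolume, mul_comm,
    ENNReal.ofReal_mul measureReal_nonneg, ofReal_measureReal]

theorem exists_ball_subset_ball_inter_ball {F : Type*} [NormedAddCommGroup F] [NormedSpace ℝ F]
    {x x₀ : F} {r ρ : ℝ} (hx : x ∈ ball x₀ r) (hρ : 0 < ρ) (hρr : ρ ≤ 2 * r) :
    ∃ z, ball z (ρ / 2) ⊆ ball x ρ ∩ ball x₀ r := by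
  have hr : 0 < r := by linarith
  set θ : ℝ := ρ / (2 * r) with hθ
  have hθ0 : 0 < θ := by positivity
  have hθ1 : θ ≤ 1 := by rw [hθ, div_le_one (by positivity)]; exact hρr
  have hθr : θ * r = ρ / 2 := by rw [hθ]; field_simp
  have hd : ‖x - x₀‖ < r := by rwa [mem_ball, dist_eq_norm] at hx
  refine ⟨x + θ • (x₀ - x), subset_inter (ball_subset_ball' ?_) (ball_subset_ball' ?_)⟩
  · have : dist (x + θ • (x₀ - x)) x = θ * ‖x - x₀‖ := by
      rw [dist_eq_norm, add_sub_cancel_left, norm_smul, Real.norm_of_nonneg hθ0.le, norm_sub_rev]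
    nlinarith
  · have : dist (x + θ • (x₀ - x)) x₀ = (1 - θ) * ‖x - x₀‖ := by
      rw [dist_eq_norm, show x + θ • (x₀ - x) - x₀ = (1 - θ) • (x - x₀) by module,
        norm_smul, Real.norm_of_nonneg (by linarith)]
    nlinarith

theorem volume_ball_inter_ball_ge {x x₀ : E n} {r ρ : ℝ} (hx : x ∈ ball x₀ r) (hρ : 0 < ρ)
    (hρr : ρ ≤ 2 * r) :
    ENNReal.ofReal (unitBallVolume n * (ρ / 2) ^ n) ≤ volume (ball x ρ ∩ ball x₀ r) := by
  obtain ⟨z, hz⟩ := exists_ball_subset_ball_inter_ball hx hρ hρr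
  exact (volume_ball_eq z (by positivity)).symm.trans_le (measure_mono hz)

theorem ofReal_mul_measure_le_setLIntegral_kernel {F : Type*} [NormedAddCommGroup F]
    [MeasurableSpace F] {μ : Measure F} {T : Set F} (hT : MeasurableSet T) {x : F} {ρ e b : ℝ}
    {g : F → ℝ} (he : 0 ≤ e) (hb : 0 ≤ b) (hg : ∀ y ∈ T, x ≠ y ∧ ‖x - y‖ ≤ ρ ∧ b ≤ g y) :
    ENNReal.ofReal (b / ρ ^ e) * μ T ≤ ∫⁻ y in T, ENNReal.ofReal (g y / ‖x - y‖ ^ e) ∂μ := by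
  rw [← setLIntegral_const]
  refine setLIntegral_mono_ae' hT (.of_forall fun y hy => ENNReal.ofReal_le_ofReal ?_)
  obtain ⟨hne, hle, hby⟩ := hg y hy
  have : 0 < ‖x - y‖ := norm_pos_iff.2 (sub_ne_zero.2 hne)
  have : 0 ≤ g y := hb.trans hby
  gcongr

/-- If the support of `w` occupies little of the ball, each of its points sees a large set of zeros
of `w` at distance at most `ρ`. -/
theorem ofReal_mul_rpow_le_setLIntegral_kernel (hs : 0 ≤ s) (hp : 0 < p) {w : E n → ℝ}
    (hw : Measurable w) {x x₀ : E n} {r ρ : ℝ} (hρ : 0 < ρ) (hρr : ρ ≤ 2 * r)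
    (hsupp : volume (w.support ∩ ball x₀ r)
      ≤ ENNReal.ofReal (unitBallVolume n * (ρ / 2) ^ n / 2)) (hx : x ∈ ball x₀ r) :
    ENNReal.ofReal (unitBallVolume n * (ρ / 2) ^ n / 2 / ρ ^ ((n : ℝ) + s * p))
        * ENNReal.ofReal (|w x| ^ p)
      ≤ ∫⁻ y in ball x₀ r, ENNReal.ofReal (|w x - w y| ^ p / ‖x - y‖ ^ ((n : ℝ) + s * p)) := by
  have hV := unitBallVolume_pos n
  set c : ℝ := unitBallVolume n * (ρ / 2) ^ n / 2 with hc
  rcases eq_or_ne (w x) 0 with hwx | hwx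
  · simp [hwx, Real.zero_rpow hp.ne']
  have hsuppm : MeasurableSet w.support := measurableSet_support hw
  set T : Set (E n) := (ball x ρ ∩ ball x₀ r) \ (w.support ∩ ball x₀ r)
  have hTm : MeasurableSet T :=
    (measurableSet_ball.inter measurableSet_ball).diff (hsuppm.inter measurableSet_ball)
  have hTvol : ENNReal.ofReal c ≤ volume T :=
    calc ENNReal.ofReal c = ENNReal.ofReal (unitBallVolume n * (ρ / 2) ^ n) - ENNReal.ofReal c := by
          rw [← ENNReal.ofReal_sub _ (by positivity)]; congr 1; rw [hc]; ring
      _ ≤ volume (ball x ρ ∩ ball x₀ r) - volume (w.support ∩ ball x₀ r) :=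
          tsub_le_tsub (volume_ball_inter_ball_ge hx hρ hρr) hsupp
      _ ≤ volume T := le_measure_sdiff
  have hTzero (y : E n) (hy : y ∈ T) : w y = 0 :=
    Function.notMem_support.1 fun h => hy.2 ⟨h, hy.1.2⟩
  calc ENNReal.ofReal (c / ρ ^ ((n : ℝ) + s * p)) * ENNReal.ofReal (|w x| ^ p)
      = ENNReal.ofReal (|w x| ^ p / ρ ^ ((n : ℝ) + s * p)) * ENNReal.ofReal c := by
        rw [← ENNReal.ofReal_mul (by positivity), ← ENNReal.ofReal_mul (by positivity)]
        congr 1; ring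
    _ ≤ ENNReal.ofReal (|w x| ^ p / ρ ^ ((n : ℝ) + s * p)) * volume T := by gcongr
    _ ≤ ∫⁻ y in T, ENNReal.ofReal (|w x - w y| ^ p / ‖x - y‖ ^ ((n : ℝ) + s * p)) := by
        refine ofReal_mul_measure_le_setLIntegral_kernel hTm (by positivity) (by positivity)
          fun y hy => ⟨?_, ?_, by rw [hTzero y hy, sub_zero]⟩
        · rintro rfl; exact hwx (hTzero x hy)
        · rw [← dist_eq_norm, dist_comm]; exact (mem_ball.1 hy.1.1).le
    _ ≤ _ := lintegral_mono_set (sdiff_subset.trans inter_subset_right)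

/-- A fractional Faber-Krahn inequality. -/
theorem setLIntegral_rpow_le_gagliardoEnergy (hs : 0 ≤ s) (hp : 0 < p) {w : E n → ℝ}
    (hw : Measurable w) {x₀ : E n} {r ρ : ℝ} (hρ : 0 < ρ) (hρr : ρ ≤ 2 * r)
    (hsupp : volume (w.support ∩ ball x₀ r)
      ≤ ENNReal.ofReal (unitBallVolume n * (ρ / 2) ^ n / 2)) :
    ∫⁻ x in ball x₀ r, ENNReal.ofReal (|w x| ^ p)
      ≤ ENNReal.ofReal (2 ^ (n + 1) / unitBallVolume n * ρ ^ (s * p))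
        * gagliardoEnergy s p w (ball x₀ r) := by
  have hV := unitBallVolume_pos n
  set c : ℝ := unitBallVolume n * (ρ / 2) ^ n / 2 / ρ ^ ((n : ℝ) + s * p) with hc
  have hinv : 2 ^ (n + 1) / unitBallVolume n * ρ ^ (s * p) * c = 1 := by
    rw [hc, Real.rpow_add hρ, Real.rpow_natCast, div_pow]
    field_simp
    ring
  calc ∫⁻ x in ball x₀ r, ENNReal.ofReal (|w x| ^ p)
      = ENNReal.ofReal (2 ^ (n + 1) / unitBallVolume n * ρ ^ (s * p)) *
        ∫⁻ x in ball x₀ r, ENNReal.ofReal c * ENNReal.ofReal (|w x| ^ p) := by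
        rw [lintegral_const_mul' _ _ ENNReal.ofReal_ne_top, ← mul_assoc,
          ← ENNReal.ofReal_mul (by positivity), hinv, ENNReal.ofReal_one, one_mul]
    _ ≤ _ := by
        gcongr
        exact setLIntegral_mono_ae' measurableSet_ball (.of_forall fun x hx =>
          ofReal_mul_rpow_le_setLIntegral_kernel hs hp hw hρ hρr hsupp hx)

/-- This is the use made of the interaction term: if `f` lies below `k - b` on a large set, it
controls the excess over `k` with a factor that is large when `b` is. -/
theorem ofReal_mul_excess_le_interaction (hs : 0 ≤ s) (hp : 1 ≤ p) {f : E n → ℝ}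
    (hf : Measurable f) {x₀ : E n} {ρ k b m : ℝ} (hρ : 0 < ρ) (hb : 0 < b)
    (hm : ENNReal.ofReal m ≤ volume ({x | f x ≤ k - b} ∩ ball x₀ (ρ / 2))) :
    ENNReal.ofReal (b ^ (p - 1) / ρ ^ ((n : ℝ) + s * p) * m)
        * excess 1 f k (volume.restrict (ball x₀ (ρ / 2)))
      ≤ interaction s p (fun x => (f x - k)⁺) (fun x => (f x - k)⁻) (ball x₀ (ρ / 2)) := by
  have hTm : MeasurableSet ({x | f x ≤ k - b} ∩ ball x₀ (ρ / 2)) :=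
    (measurableSet_le hf measurable_const).inter measurableSet_ball
  rw [excess, ← lintegral_const_mul' _ _ ENNReal.ofReal_ne_top]
  refine setLIntegral_mono_ae' measurableSet_ball (.of_forall fun x hx => ?_)
  rcases le_or_gt (f x) k with hk | hk
  · rw [posPart_eq_zero.2 (by linarith)]; simp
  rw [mul_comm, Real.rpow_one, ENNReal.ofReal_mul (by positivity)]
  gcongr
  refine (mul_le_mul_right hm _).trans <|
    (ofReal_mul_measure_le_setLIntegral_kernel hTm (by positivity) (by positivity)
      fun y hy => ⟨?_, ?_, ?_⟩).trans (setLIntegral_le_lintegral _ _)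
  · rintro rfl
    have : f x ≤ k - b := hy.1
    linarith
  · rw [← dist_eq_norm]
    have := mem_ball.1 hx
    have := mem_ball.1 hy.2
    have := dist_triangle_right x y x₀
    linarith
  · have : f y ≤ k - b := hy.1
    exact Real.rpow_le_rpow hb.le ((by linarith : b ≤ -(f y - k)).trans (neg_le_negPart _))
      (by linarith)

/-! ### De Giorgi iteration -/

section EnergyEstimate

variable {R Λ K Q l l' : ℝ} {X : Type*} [MeasurableSpace X] {μ : Measure X} {g : X → ℝ}

theorem ofReal_mul_measure_superlevel_le (hp : 0 ≤ p) (hlam : 0 ≤ lam) (hd : 0 ≤ d)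
    (hg : Measurable g) (hK : 0 < K) (hQ : 0 < Q) (hl : l + K / Q ≤ l') {ρ : ℝ} (hρ : 0 ≤ ρ)
    (hρR : ρ ≤ R) (hR : 0 < R) (hdK : R ^ (lam + s * p) * d ^ p ≤ Λ * K ^ p) :
    ENNReal.ofReal (ρ ^ lam * d ^ p) * μ {x | l' < g x}
      ≤ ENNReal.ofReal (Λ * Q ^ p * R ^ (-(s * p))) * excess p g l μ := by
  have hcoef : ρ ^ lam * d ^ p ≤ Λ * K ^ p * R ^ (-(s * p)) :=
    calc ρ ^ lam * d ^ p ≤ R ^ lam * d ^ p := by gcongr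
      _ = R ^ (lam + s * p) * d ^ p * R ^ (-(s * p)) := by
          rw [mul_right_comm, ← Real.rpow_add hR, add_neg_cancel_right]
      _ ≤ Λ * K ^ p * R ^ (-(s * p)) := by gcongr
  calc ENNReal.ofReal (ρ ^ lam * d ^ p) * μ {x | l' < g x}
      ≤ ENNReal.ofReal (Λ * K ^ p * R ^ (-(s * p)))
        * (ENNReal.ofReal ((1 / (K / Q)) ^ p) * excess p g l μ) := by
        gcongr
        exact measure_superlevel_le hp hg (by positivity) hl
    _ = ENNReal.ofReal (Λ * Q ^ p * R ^ (-(s * p))) * excess p g l μ := by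
        rw [← mul_assoc, ← ENNReal.ofReal_mul' (by positivity), one_div_div,
          Real.div_rpow hQ.le hK.le]
        congr 2
        field_simp

theorem rpow_div_sub_rpow_le (hs : s ≤ 1) (hp : 0 ≤ p) (hR : 0 < R) (hQ : 0 < Q) {ρ : ℝ}
    (hρ : 0 ≤ ρ) (hρR : ρ ≤ R) :
    ρ ^ ((1 - s) * p) / (R / Q) ^ p ≤ Q ^ p * R ^ (-(s * p)) := by
  have : 0 ≤ (1 - s) * p := mul_nonneg (sub_nonneg.2 hs) hp
  calc ρ ^ ((1 - s) * p) / (R / Q) ^ p ≤ R ^ ((1 - s) * p) / (R / Q) ^ p := by gcongr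
    _ = Q ^ p * R ^ (-(s * p)) := by
        rw [Real.div_rpow hR.le hQ.le, show (1 - s) * p = p + -(s * p) by ring, Real.rpow_add hR]
        field_simp

theorem ofReal_mul_excess_one_mul_le (hp : 1 ≤ p) {e : ℝ} (he : 0 ≤ e) (hK : 0 < K) (hQ : 0 < Q)
    (hl : l + K / Q ≤ l') {ρ : ℝ} (hρ : 0 ≤ ρ) (hρR : ρ ≤ R) (hR : 0 < R) {t : ℝ≥0∞}
    (ht : t ≤ ENNReal.ofReal (Λ * K ^ (p - 1) * R ^ (-(s * p)))) :
    ENNReal.ofReal (ρ ^ e / (R / Q) ^ e) * excess 1 g l' μ * t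
      ≤ ENNReal.ofReal (Λ * Q ^ (e + (p - 1)) * R ^ (-(s * p))) * excess p g l μ := by
  have hcoef : ρ ^ e / (R / Q) ^ e ≤ Q ^ e := by
    rw [← Real.div_rpow hρ (by positivity)]
    refine Real.rpow_le_rpow (by positivity) ?_ he
    rw [div_le_iff₀ (by positivity), mul_div_cancel₀ _ hQ.ne']
    exact hρR
  calc ENNReal.ofReal (ρ ^ e / (R / Q) ^ e) * excess 1 g l' μ * t
      ≤ ENNReal.ofReal (Q ^ e) * (ENNReal.ofReal ((1 / (K / Q)) ^ (p - 1)) * excess p g l μ)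
        * ENNReal.ofReal (Λ * K ^ (p - 1) * R ^ (-(s * p))) := by
        gcongr
        exact excess_le_of_add_le one_pos hp (by positivity) hl
    _ = ENNReal.ofReal (Λ * Q ^ (e + (p - 1)) * R ^ (-(s * p))) * excess p g l μ := by
        rw [← mul_assoc, mul_right_comm, ← ENNReal.ofReal_mul (by positivity),
          ← ENNReal.ofReal_mul (by positivity), one_div_div, Real.div_rpow hQ.le hK.le,
          Real.rpow_add hQ]
        congr 2
        field_simp

theorem SuperlevelCaccioppoli.gagliardoEnergy_le (hs : 0 ≤ s) (hs1 : s ≤ 1) (hp : 1 ≤ p)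
    (hH : 0 ≤ H) (hlam : 0 ≤ lam) (hd : 0 ≤ d) {f : E n → ℝ} (hfm : Measurable f) {x₀ : E n}
    (hR : 0 < R) (hf : SuperlevelCaccioppoli s p d H lam f x₀ R) {r r' : ℝ} (hΛ : 0 ≤ Λ)
    (hK : 0 < K) (hQ : 1 ≤ Q) (hr : R / 2 ≤ r) (hrr' : r' - r = R / Q) (hr' : r' ≤ R)
    (hl : l + K / Q ≤ l') (hdK : R ^ (lam + s * p) * d ^ p ≤ Λ * K ^ p)
    (htail : tailIntegral s p (fun x => (f x - l)⁺) x₀ (R / 2)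
      ≤ ENNReal.ofReal (Λ * K ^ (p - 1) * R ^ (-(s * p)))) :
    gagliardoEnergy s p (fun x => (f x - l')⁺) (ball x₀ r)
      ≤ ENNReal.ofReal (H * (2 * Λ + 1) * Q ^ ((n : ℝ) + s * p + p) * R ^ (-(s * p)))
        * excess p f l (volume.restrict (ball x₀ r')) := by
  have hQ0 : 0 < Q := by linarith
  have hRQ : 0 < R / Q := by positivity
  have hll' : l ≤ l' := le_trans (le_add_of_nonneg_right (by positivity)) hl
  have he : 0 ≤ (n : ℝ) + s * p := by positivity
  have hset : volume ({x | l' < f x} ∩ ball x₀ r') = volume.restrict (ball x₀ r') {x | l' < f x} :=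
    (Measure.restrict_apply (measurableSet_lt measurable_const hfm)).symm
  have htail' := (tailIntegral_posPart_sub_anti hp f hll' x₀ hr).trans htail
  set Y := excess p f l (volume.restrict (ball x₀ r'))
  calc gagliardoEnergy s p (fun x => (f x - l')⁺) (ball x₀ r)
      ≤ _ := le_self_add.trans (hf r r' (by linarith) (by linarith) hr' l')
    _ ≤ ENNReal.ofReal H * (ENNReal.ofReal (Λ * Q ^ p * R ^ (-(s * p))) * Y
        + ENNReal.ofReal (Q ^ p * R ^ (-(s * p))) * Y
        + ENNReal.ofReal (Λ * Q ^ ((n : ℝ) + s * p + (p - 1)) * R ^ (-(s * p))) * Y) := by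
        rw [hset, hrr']
        gcongr ENNReal.ofReal H * (?_ + ENNReal.ofReal ?_ * ?_ + ?_)
        · exact ofReal_mul_measure_superlevel_le (by linarith) hlam hd hfm hK hQ0 hl (by linarith)
            hr' hR hdK
        · exact rpow_div_sub_rpow_le hs1 (by linarith) hR hQ0 (by linarith) hr'
        · exact excess_anti (by linarith) hll'
        · exact ofReal_mul_excess_one_mul_le hp he hK hQ0 hl (by linarith) hr' hR htail'
    _ = ENNReal.ofReal (H * (Λ * Q ^ p + Q ^ p + Λ * Q ^ ((n : ℝ) + s * p + (p - 1)))
        * R ^ (-(s * p))) * Y := by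
        rw [← add_mul, ← add_mul, ← mul_assoc, ← ENNReal.ofReal_add (by positivity) (by positivity),
          ← ENNReal.ofReal_add (by positivity) (by positivity), ← ENNReal.ofReal_mul hH]
        congr 2; ring
    _ ≤ ENNReal.ofReal (H * (Λ * Q ^ ((n : ℝ) + s * p + p) + Q ^ ((n : ℝ) + s * p + p)
        + Λ * Q ^ ((n : ℝ) + s * p + p)) * R ^ (-(s * p))) * Y := by
        gcongr <;> linarith
    _ = _ := by congr 2; ring

end EnergyEstimate

section DeGiorgiIteration

/-- The last hypothesis says that the superlevel set occupies so little of the ball that the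
Faber-Krahn inequality applies at scale `τ R`. -/
theorem SuperlevelCaccioppoli.excess_le (hs : 0 ≤ s) (hs1 : s ≤ 1) (hp : 1 ≤ p)
    (hH : 0 ≤ H) (hlam : 0 ≤ lam) (hd : 0 ≤ d) {f : E n → ℝ} (hfm : Measurable f) {x₀ : E n}
    {R Λ K Q l l' r r' τ : ℝ} (hR : 0 < R) (hf : SuperlevelCaccioppoli s p d H lam f x₀ R)
    (hΛ : 0 ≤ Λ) (hK : 0 < K) (hQ : 1 ≤ Q) (hτ : 0 < τ) (hτ1 : τ ≤ 1)
    (hr : R / 2 ≤ r) (hrr' : r' - r = R / Q) (hr' : r' ≤ R)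
    (hl : l + K / Q ≤ l') (hdK : R ^ (lam + s * p) * d ^ p ≤ Λ * K ^ p)
    (htail : tailIntegral s p (fun x => (f x - l)⁺) x₀ (R / 2)
      ≤ ENNReal.ofReal (Λ * K ^ (p - 1) * R ^ (-(s * p))))
    (hexcess : excess p f l (volume.restrict (ball x₀ r'))
      ≤ ENNReal.ofReal ((K / Q) ^ p * (unitBallVolume n * (τ * R / 2) ^ n / 2))) :
    excess p f l' (volume.restrict (ball x₀ r))
      ≤ ENNReal.ofReal (2 ^ (n + 1) / unitBallVolume n * (H * (2 * Λ + 1)) * τ ^ (s * p)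
          * Q ^ ((n : ℝ) + s * p + p)) * excess p f l (volume.restrict (ball x₀ r')) := by
  have hV := unitBallVolume_pos n
  have hKQ : 0 < K / Q := by positivity
  have hRQ : 0 < R / Q := by positivity
  have hball : ball x₀ r ⊆ ball x₀ r' := ball_subset_ball (by linarith)
  have hscale : R ^ (s * p) * R ^ (-(s * p)) = 1 := by
    rw [← Real.rpow_add hR, add_neg_cancel, Real.rpow_zero]
  have hsupp : volume ((fun x => (f x - l')⁺).support ∩ ball x₀ r)
      ≤ ENNReal.ofReal (unitBallVolume n * (τ * R / 2) ^ n / 2) := by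
    have hset : (fun x => (f x - l')⁺).support = {x | l' < f x} := by
      ext x
      simp only [Function.mem_support, mem_ofPred_eq, ne_eq, posPart_eq_zero, sub_nonpos, not_le]
    calc volume ((fun x => (f x - l')⁺).support ∩ ball x₀ r)
        ≤ volume.restrict (ball x₀ r') {x | l' < f x} := by
          rw [hset, Measure.restrict_apply (measurableSet_lt measurable_const hfm)]
          exact measure_mono (inter_subset_inter_right _ hball)
      _ ≤ _ := measure_superlevel_le (by linarith) hfm hKQ hl
      _ ≤ _ := mul_le_mul_right hexcess _
      _ = _ := by
          rw [← ENNReal.ofReal_mul (by positivity), ← mul_assoc, ← Real.mul_rpow (by positivity)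
            hKQ.le, one_div_mul_cancel hKQ.ne', Real.one_rpow, one_mul]
  have hFK := setLIntegral_rpow_le_gagliardoEnergy (s := s) (p := p) hs (by linarith)
    (by fun_prop) (by positivity) (by nlinarith) hsupp
  simp only [abs_of_nonneg (posPart_nonneg (_ : ℝ))] at hFK
  calc excess p f l' (volume.restrict (ball x₀ r))
      ≤ _ := hFK
    _ ≤ _ := mul_le_mul_right (hf.gagliardoEnergy_le hs hs1 hp hH hlam hd hfm hR hΛ hK hQ hr hrr'
        hr' hl hdK htail) _
    _ = _ := by
        rw [← mul_assoc, ← ENNReal.ofReal_mul (by positivity), Real.mul_rpow hτ.le hR.le]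
        congr 2
        linear_combination (2 ^ (n + 1) / unitBallVolume n * (H * (2 * Λ + 1)) * τ ^ (s * p)
          * Q ^ ((n : ℝ) + s * p + p)) * hscale

/-- The radii `R = r_0 > r_1 > ⋯` of the De Giorgi iteration, which tend to `R / 2`. -/
def iterRadius (R : ℝ) (j : ℕ) : ℝ := R * (1 + (1 / 2) ^ j) / 2

/-- The levels `k = k_0 < k_1 < ⋯` of the De Giorgi iteration, which tend to `k + K`. -/
def iterLevel (k K : ℝ) (j : ℕ) : ℝ := k + K * (1 - (1 / 2) ^ j)

variable {R k K : ℝ}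

theorem half_le_iterRadius (hR : 0 ≤ R) (j : ℕ) : R / 2 ≤ iterRadius R j := by
  have : 0 ≤ R * (1 / 2) ^ j := by positivity
  rw [iterRadius]
  linarith

theorem iterRadius_le (hR : 0 ≤ R) (j : ℕ) : iterRadius R j ≤ R := by
  have : R * (1 / 2) ^ j ≤ R :=
    mul_le_of_le_one_right hR (pow_le_one₀ (by norm_num) (by norm_num))
  rw [iterRadius]
  linarith

theorem iterRadius_sub_succ (R : ℝ) (j : ℕ) :
    iterRadius R j - iterRadius R (j + 1) = R / 2 ^ (j + 2) := by
  simp only [iterRadius, pow_succ, one_div, inv_pow]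
  field_simp
  ring

theorem le_iterLevel (hK : 0 ≤ K) (j : ℕ) : k ≤ iterLevel k K j :=
  le_add_of_nonneg_right (mul_nonneg hK (sub_nonneg.2 (pow_le_one₀ (by norm_num) (by norm_num))))

theorem iterLevel_le (hK : 0 ≤ K) (j : ℕ) : iterLevel k K j ≤ k + K :=
  add_le_add_right (mul_le_of_le_one_right hK (sub_le_self 1 (by positivity))) k

theorem iterLevel_add_le (hK : 0 ≤ K) (j : ℕ) :
    iterLevel k K j + K / 2 ^ (j + 2) ≤ iterLevel k K (j + 1) := by
  have hstep : iterLevel k K (j + 1) - iterLevel k K j = 2 * (K / 2 ^ (j + 2)) := by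
    simp only [iterLevel, pow_succ, one_div, inv_pow]
    field_simp
    ring
  have : 0 ≤ K / 2 ^ (j + 2) := by positivity
  linarith

theorem two_pow_add_two_rpow (j : ℕ) (a : ℝ) : ((2 : ℝ) ^ (j + 2)) ^ a = 4 ^ a * (2 ^ a) ^ j := by
  rw [pow_add, mul_comm, Real.mul_rpow (by norm_num) (by positivity),
    Real.rpow_pow_comm (by norm_num)]
  norm_num

/-- The iteration decays like `q ^ j` when the `j`-th step uses the Faber-Krahn inequality at scale
`σ μ ^ j R`: then `μ` compensates the growth `2 ^ (N j)` of the constants and `σ` makes the first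
step contract. -/
theorem exists_iteration_constants (hp : 0 < p) {β N D : ℝ} (hβ : 0 < β) (hN : 0 ≤ N) (hD : 0 < D)
    (n : ℕ) : ∃ σ μ q : ℝ, (0 < σ ∧ σ ≤ 1) ∧ (0 < μ ∧ μ ≤ 1) ∧ (0 < q ∧ q < 1) ∧
      2 ^ p * q = μ ^ n ∧ D * σ ^ β ≤ q ∧ μ ^ β * 2 ^ N = 1 := by
  set μ : ℝ := 2 ^ (-(N / β)) with hμ
  have hμ0 : 0 < μ := by positivity
  have hμ1 : μ ≤ 1 :=
    Real.rpow_le_one_of_one_le_of_nonpos (by norm_num) (neg_nonpos.2 (by positivity))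
  have hμN : μ ^ β * 2 ^ N = 1 := by
    rw [hμ, ← Real.rpow_mul (by norm_num), ← Real.rpow_add (by norm_num), neg_mul,
      div_mul_cancel₀ _ hβ.ne', neg_add_cancel, Real.rpow_zero]
  set q : ℝ := μ ^ n / 2 ^ p with hq
  have hq1 : q < 1 := by
    rw [hq, div_lt_one (by positivity)]
    exact (pow_le_one₀ hμ0.le hμ1).trans_lt (Real.one_lt_rpow (by norm_num) hp)
  refine ⟨min 1 ((q / D) ^ β⁻¹), μ, q, ⟨lt_min one_pos (by positivity), min_le_left _ _⟩,
    ⟨hμ0, hμ1⟩, ⟨by positivity, hq1⟩, mul_div_cancel₀ _ (by positivity), ?_, hμN⟩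
  rw [← le_div_iff₀' hD]
  calc min 1 ((q / D) ^ β⁻¹) ^ β ≤ ((q / D) ^ β⁻¹) ^ β := by
        gcongr; exact min_le_right _ _
    _ = q / D := Real.rpow_inv_rpow (by positivity) hβ.ne'

theorem SuperlevelCaccioppoli.excess_iter_le (hs : 0 ≤ s) (hs1 : s ≤ 1) (hp : 1 ≤ p)
    (hH : 0 ≤ H) (hlam : 0 ≤ lam) (hd : 0 ≤ d) {f : E n → ℝ} (hfm : Measurable f) {x₀ : E n}
    {Λ σ μ q : ℝ} (hR : 0 < R) (hf : SuperlevelCaccioppoli s p d H lam f x₀ R) (hΛ : 0 ≤ Λ)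
    (hK : 0 < K) (hdK : R ^ (lam + s * p) * d ^ p ≤ Λ * K ^ p)
    (htail : tailIntegral s p (fun x => (f x - k)⁺) x₀ (R / 2)
      ≤ ENNReal.ofReal (Λ * K ^ (p - 1) * R ^ (-(s * p))))
    (hσ : 0 < σ ∧ σ ≤ 1) (hμ : 0 < μ ∧ μ ≤ 1) (hqμ : 2 ^ p * q = μ ^ n)
    (hσq : 2 ^ (n + 1) / unitBallVolume n * (H * (2 * Λ + 1)) * 4 ^ ((n : ℝ) + s * p + p)
      * σ ^ (s * p) ≤ q)
    (hμN : μ ^ (s * p) * 2 ^ ((n : ℝ) + s * p + p) = 1)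
    (hexcess : excess p f k (volume.restrict (ball x₀ R))
      ≤ ENNReal.ofReal (unitBallVolume n * σ ^ n / (2 ^ (n + 1) * 4 ^ p) * K ^ p * R ^ n)) (j : ℕ) :
    excess p f (iterLevel k K j) (volume.restrict (ball x₀ (iterRadius R j)))
      ≤ ENNReal.ofReal (unitBallVolume n * σ ^ n / (2 ^ (n + 1) * 4 ^ p) * K ^ p * R ^ n * q ^ j)
      := by
  have hV := unitBallVolume_pos n
  obtain ⟨hσ0, hσ1⟩ := hσ
  obtain ⟨hμ0, hμ1⟩ := hμ
  set θ : ℝ := unitBallVolume n * σ ^ n / (2 ^ (n + 1) * 4 ^ p) with hθ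
  set N : ℝ := (n : ℝ) + s * p + p
  induction j with
  | zero =>
    simpa only [iterLevel, iterRadius, pow_zero, sub_self, mul_zero, add_zero, mul_one,
      show R * (1 + 1) / 2 = R by ring] using hexcess
  | succ j ih =>
    have hsmall : θ * K ^ p * R ^ n * q ^ j
        = (K / 2 ^ (j + 2)) ^ p * (unitBallVolume n * (σ * μ ^ j * R / 2) ^ n / 2) := by
      have hq : q = μ ^ n / 2 ^ p := by rw [← hqμ, mul_div_cancel_left₀ _ (by positivity)]
      rw [Real.div_rpow hK.le (by positivity), two_pow_add_two_rpow, hθ, hq, div_pow, div_pow]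
      field_simp
      ring
    have hcontract : 2 ^ (n + 1) / unitBallVolume n * (H * (2 * Λ + 1)) * (σ * μ ^ j) ^ (s * p)
        * ((2 : ℝ) ^ (j + 2)) ^ N ≤ q := by
      calc _ = 2 ^ (n + 1) / unitBallVolume n * (H * (2 * Λ + 1)) * 4 ^ N * σ ^ (s * p)
            * (μ ^ (s * p) * 2 ^ N) ^ j := by
            rw [two_pow_add_two_rpow, Real.mul_rpow hσ0.le (by positivity),
              ← Real.rpow_pow_comm hμ0.le, mul_pow]
            ring
        _ ≤ q := by rwa [hμN, one_pow, mul_one]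
    have hstep := hf.excess_le (τ := σ * μ ^ j) hs hs1 hp hH hlam hd hfm hR hΛ hK
      (one_le_pow₀ one_le_two) (by positivity) (mul_le_one₀ hσ1 (by positivity)
        (pow_le_one₀ hμ0.le hμ1)) (half_le_iterRadius hR.le (j + 1)) (iterRadius_sub_succ R j)
      (iterRadius_le hR.le j) (iterLevel_add_le (k := k) hK.le j) hdK
      ((tailIntegral_posPart_sub_anti hp f (le_iterLevel hK.le j) x₀ le_rfl).trans htail)
      (ih.trans_eq (congrArg ENNReal.ofReal hsmall))
    refine (hstep.trans (mul_le_mul' (ENNReal.ofReal_le_ofReal hcontract) ih)).trans_eq ?_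
    rw [← ENNReal.ofReal_mul (le_trans (by positivity) hcontract), pow_succ']
    congr 1; ring

theorem exists_excess_threshold (hs : 0 < s) (hs1 : s ≤ 1) (hp : 1 ≤ p)
    (hH : 0 < H) (hlam : 0 ≤ lam) (n : ℕ) {Λ : ℝ} (hΛ : 0 ≤ Λ) :
    ∃ θ : ℝ, 0 < θ ∧ ∀ d : ℝ, 0 ≤ d → ∀ f : E n → ℝ, Measurable f → ∀ (x₀ : E n) (R : ℝ),
      0 < R → SuperlevelCaccioppoli s p d H lam f x₀ R → ∀ k K : ℝ, 0 < K →
      R ^ (lam + s * p) * d ^ p ≤ Λ * K ^ p →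
      tailIntegral s p (fun x => (f x - k)⁺) x₀ (R / 2)
        ≤ ENNReal.ofReal (Λ * K ^ (p - 1) * R ^ (-(s * p))) →
      excess p f k (volume.restrict (ball x₀ R)) ≤ ENNReal.ofReal (θ * K ^ p * R ^ n) →
      ∀ᵐ x ∂volume.restrict (ball x₀ (R / 2)), f x ≤ k + K := by
  have hV := unitBallVolume_pos n
  obtain ⟨σ, μ, q, hσ, hμ, ⟨hq0, hq1⟩, hqμ, hσq, hμN⟩ := exists_iteration_constants
    (p := p) (β := s * p) (N := (n : ℝ) + s * p + p)
    (D := 2 ^ (n + 1) / unitBallVolume n * (H * (2 * Λ + 1)) * 4 ^ ((n : ℝ) + s * p + p))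
    (by positivity) (by positivity) (by positivity) (by positivity) n
  have hσ0 := hσ.1
  refine ⟨unitBallVolume n * σ ^ n / (2 ^ (n + 1) * 4 ^ p), by positivity, ?_⟩
  intro d hd f hfm x₀ R hR hf k K hK hdK htail hexcess
  have hiter := hf.excess_iter_le hs.le hs1 hp hH.le hlam hd hfm hR hΛ hK hdK htail hσ hμ hqμ hσq
    hμN hexcess
  set c : ℝ := unitBallVolume n * σ ^ n / (2 ^ (n + 1) * 4 ^ p) * K ^ p * R ^ n
  have hlim : Filter.Tendsto (fun j : ℕ => ENNReal.ofReal (c * q ^ j)) Filter.atTop (nhds 0) := by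
    rw [← ENNReal.ofReal_zero, ← mul_zero c]
    exact ENNReal.tendsto_ofReal ((tendsto_pow_atTop_nhds_zero_of_lt_one hq0.le hq1).const_mul c)
  refine ae_le_of_excess_eq_zero (a := p) hfm (le_antisymm ?_ zero_le)
  refine ge_of_tendsto' hlim fun j => le_trans ?_ (hiter j)
  exact (excess_anti (by linarith) (iterLevel_le hK.le j)).trans
    (excess_mono_measure (Measure.restrict_mono (ball_subset_ball (half_le_iterRadius hR.le j))
      le_rfl))

end DeGiorgiIteration

/-! ### Kernel integrals and tails -/

section ExteriorKernel

variable {F : Type*} [NormedAddCommGroup F] [NormedSpace ℝ F] [FiniteDimensional ℝ F]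
  [MeasurableSpace F] [BorelSpace F] (μ : Measure F) [μ.IsAddHaarMeasure]

theorem lintegral_comp_inv_smul_sub (x₀ : F) {r : ℝ} (hr : 0 < r) (G : F → ℝ≥0∞) :
    ∫⁻ x, G (r⁻¹ • (x - x₀)) ∂μ
      = ENNReal.ofReal (r ^ Module.finrank ℝ F) * ∫⁻ y, G y ∂μ := by
  have hr' : r⁻¹ ≠ 0 := inv_ne_zero hr.ne'
  rw [lintegral_sub_right_eq_self (fun x => G (r⁻¹ • x)),
    ← (measurableEmbedding_const_smul₀ hr').lintegral_map, Measure.map_addHaar_smul _ hr',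
    lintegral_smul_measure, inv_pow, inv_inv, abs_of_pos (by positivity), smul_eq_mul]

theorem setLIntegral_compl_ball_comp_inv_smul_sub (x₀ : F) {r : ℝ} (hr : 0 < r) (G : F → ℝ≥0∞) :
    ∫⁻ x in (ball x₀ r)ᶜ, G (r⁻¹ • (x - x₀)) ∂μ
      = ENNReal.ofReal (r ^ Module.finrank ℝ F) * ∫⁻ y in (ball 0 1)ᶜ, G y ∂μ := by
  have hpre (x : F) : r⁻¹ • (x - x₀) ∈ (ball (0 : F) 1)ᶜ ↔ x ∈ (ball x₀ r)ᶜ := by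
    simp only [mem_compl_iff, mem_ball, dist_eq_norm, sub_zero, norm_smul, norm_inv,
      Real.norm_of_nonneg hr.le, inv_mul_lt_iff₀ hr, mul_one]
  rw [← lintegral_indicator measurableSet_ball.compl,
    ← lintegral_indicator measurableSet_ball.compl, ← lintegral_comp_inv_smul_sub μ x₀ hr]
  refine lintegral_congr fun x => ?_
  by_cases hx : x ∈ (ball x₀ r)ᶜ
  · rw [indicator_of_mem hx, indicator_of_mem ((hpre x).2 hx)]
  · rw [indicator_of_notMem hx, indicator_of_notMem (mt (hpre x).1 hx)]

theorem setLIntegral_compl_ball_kernel_eq (x₀ : F) {r : ℝ} (hr : 0 < r) (e : ℝ) (g : ℝ → ℝ) :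
    ∫⁻ x in (ball x₀ r)ᶜ, ENNReal.ofReal (g (‖x - x₀‖ / r) / ‖x - x₀‖ ^ e) ∂μ
      = ENNReal.ofReal (r ^ (Module.finrank ℝ F - e)) *
        ∫⁻ y in (ball 0 1)ᶜ, ENNReal.ofReal (g ‖y‖ / ‖y‖ ^ e) ∂μ := by
  have hscale (x : F) : ENNReal.ofReal (g (‖x - x₀‖ / r) / ‖x - x₀‖ ^ e)
      = ENNReal.ofReal (r ^ (-e)) *
        ENNReal.ofReal (g ‖r⁻¹ • (x - x₀)‖ / ‖r⁻¹ • (x - x₀)‖ ^ e) := by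
    rw [norm_smul, norm_inv, Real.norm_of_nonneg hr.le, inv_mul_eq_div,
      ← ENNReal.ofReal_mul (by positivity), Real.div_rpow (norm_nonneg _) hr.le,
      Real.rpow_neg hr.le]
    congr 1
    field_simp
  simp only [hscale]
  rw [lintegral_const_mul' _ _ ENNReal.ofReal_ne_top, setLIntegral_compl_ball_comp_inv_smul_sub μ x₀
    hr fun y => ENNReal.ofReal (g ‖y‖ / ‖y‖ ^ e), ← mul_assoc, ← ENNReal.ofReal_mul (by positivity),
    ← Real.rpow_natCast, ← Real.rpow_add hr, neg_add_eq_sub]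

theorem setLIntegral_compl_ball_one_div_rpow_lt_top {e : ℝ} (he : Module.finrank ℝ F < e) :
    ∫⁻ y in (ball 0 1)ᶜ, ENNReal.ofReal (1 / ‖y‖ ^ e) ∂μ < ∞ := by
  have he0 : 0 ≤ e := (Nat.cast_nonneg _).trans he.le
  calc ∫⁻ y in (ball 0 1)ᶜ, ENNReal.ofReal (1 / ‖y‖ ^ e) ∂μ
      ≤ ∫⁻ y in (ball 0 1)ᶜ, ENNReal.ofReal (2 ^ e) * ENNReal.ofReal ((1 + ‖y‖) ^ (-e)) ∂μ := by
        refine setLIntegral_mono_ae' measurableSet_ball.compl (.of_forall fun y hy => ?_)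
        have hy1 : 1 ≤ ‖y‖ := by simpa using hy
        rw [← ENNReal.ofReal_mul (by positivity)]
        refine ENNReal.ofReal_le_ofReal ?_
        rw [Real.rpow_neg (by positivity), ← div_eq_mul_inv,
          div_le_div_iff₀ (by positivity) (by positivity), one_mul,
          ← Real.mul_rpow (by norm_num) (by positivity)]
        exact Real.rpow_le_rpow (by positivity) (by linarith) he0
    _ ≤ ENNReal.ofReal (2 ^ e) * ∫⁻ y, ENNReal.ofReal ((1 + ‖y‖) ^ (-e)) ∂μ := by
        rw [← lintegral_const_mul' _ _ ENNReal.ofReal_ne_top]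
        exact setLIntegral_le_lintegral _ _
    _ < ∞ := ENNReal.mul_lt_top ENNReal.ofReal_lt_top (finite_integral_one_add_norm he)

theorem rpow_sub_one_rpow_div_le {α q γ e t : ℝ} (hα : 0 ≤ α) (hq : 0 ≤ q) (hαq : α * q ≤ γ)
    (ht : 1 ≤ t) : ((4 * t) ^ α - 1) ^ q / t ^ e ≤ 4 ^ γ * (1 / t ^ (e - γ)) := by
  have hone : 1 ≤ (4 * t) ^ α := Real.one_le_rpow (by linarith) hα
  have hnum : ((4 * t) ^ α - 1) ^ q ≤ 4 ^ γ * t ^ γ :=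
    calc ((4 * t) ^ α - 1) ^ q ≤ ((4 * t) ^ α) ^ q := by
          gcongr
          linarith
      _ = (4 * t) ^ (α * q) := (Real.rpow_mul (by positivity) _ _).symm
      _ ≤ (4 * t) ^ γ := Real.rpow_le_rpow_of_exponent_le (by linarith) hαq
      _ = 4 ^ γ * t ^ γ := Real.mul_rpow (by norm_num) (by positivity)
  calc ((4 * t) ^ α - 1) ^ q / t ^ e ≤ 4 ^ γ * t ^ γ / t ^ e := by gcongr
    _ = 4 ^ γ * (1 / t ^ (e - γ)) := by
        rw [Real.rpow_sub (by positivity)]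
        field_simp

theorem tendsto_rpow_sub_one_rpow_div {q t : ℝ} (hq : 0 < q) (ht : 0 < t) (e : ℝ) :
    Filter.Tendsto (fun α : ℝ => ((4 * t) ^ α - 1) ^ q / t ^ e) (nhds 0) (nhds 0) := by
  have h4t : 4 * t ≠ 0 := by positivity
  have hbase : Filter.Tendsto (fun α : ℝ => (4 * t) ^ α - 1) (nhds 0)
      (nhds ((4 * t) ^ (0 : ℝ) - 1)) :=
    (Real.continuousAt_const_rpow h4t).tendsto.sub_const 1
  simpa [Real.zero_rpow hq.ne'] using
    (hbase.rpow_const (p := q) (Or.inr hq.le)).div_const (t ^ e)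

theorem tendsto_setLIntegral_rpow_sub_one {q e : ℝ} (hq : 0 < q) (he : Module.finrank ℝ F < e) :
    Filter.Tendsto (fun α : ℝ => ∫⁻ y in (ball 0 1)ᶜ,
      ENNReal.ofReal (((4 * ‖y‖) ^ α - 1) ^ q / ‖y‖ ^ e) ∂μ) (nhdsWithin 0 (Ioi 0)) (nhds 0) := by
  set γ : ℝ := (e - Module.finrank ℝ F) / 2 with hγ
  have hγ0 : 0 < γ := by linarith
  have hout : ∀ᵐ y ∂μ.restrict (ball 0 1)ᶜ, 1 ≤ ‖y‖ :=
    (ae_restrict_mem measurableSet_ball.compl).mono fun y hy => by simpa using hy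
  have hsmall : ∀ᶠ α : ℝ in nhdsWithin 0 (Ioi 0), 0 < α ∧ α * q < γ :=
    eventually_mem_nhdsWithin.and <| nhdsWithin_le_nhds <|
      (Continuous.tendsto' (f := (· * q)) (by fun_prop) _ _ (zero_mul q)).eventually_lt_const hγ0
  rw [← lintegral_zero (μ := μ.restrict (ball 0 1)ᶜ)]
  refine tendsto_lintegral_filter_of_dominated_convergence
    (fun y => ENNReal.ofReal (4 ^ γ) * ENNReal.ofReal (1 / ‖y‖ ^ (e - γ)))
    (.of_forall fun α => by fun_prop) ?_ ?_ ?_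
  · filter_upwards [hsmall] with α hα
    filter_upwards [hout] with y hy
    rw [← ENNReal.ofReal_mul (by positivity)]
    exact ENNReal.ofReal_le_ofReal (rpow_sub_one_rpow_div_le hα.1.le hq.le hα.2.le hy)
  · rw [lintegral_const_mul' _ _ ENNReal.ofReal_ne_top]
    exact (ENNReal.mul_lt_top ENNReal.ofReal_lt_top
      (setLIntegral_compl_ball_one_div_rpow_lt_top μ (by linarith))).ne
  · filter_upwards [hout] with y hy
    rw [← ENNReal.ofReal_zero]
    exact ENNReal.tendsto_ofReal
      ((tendsto_rpow_sub_one_rpow_div hq (by linarith) e).mono_left nhdsWithin_le_nhds)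

end ExteriorKernel

section Tail

/-- The integral `∫_{|y| ≥ 1} |y|^{-n-β} dy` of the kernel, through which the tails of constants
are expressed. -/
def exteriorKernelIntegral (n : ℕ) (β : ℝ) : ℝ :=
  (∫⁻ y in (ball (0 : E n) 1)ᶜ, ENNReal.ofReal (1 / ‖y‖ ^ ((n : ℝ) + β))).toReal

theorem exteriorKernelIntegral_nonneg (n : ℕ) (β : ℝ) : 0 ≤ exteriorKernelIntegral n β :=
  ENNReal.toReal_nonneg

theorem tailIntegral_const (hs : 0 < s) (hp : 0 < p) {c : ℝ} (hc : 0 ≤ c) (x₀ : E n) {r : ℝ}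
    (hr : 0 < r) : tailIntegral s p (fun _ => c) x₀ r
      = ENNReal.ofReal (c ^ (p - 1) * exteriorKernelIntegral n (s * p) * r ^ (-(s * p))) := by
  have hfin : Module.finrank ℝ (E n) < (n : ℝ) + s * p := by
    rw [finrank_euclideanSpace_fin]
    exact lt_add_of_pos_right _ (by positivity)
  have hscale := setLIntegral_compl_ball_kernel_eq volume x₀ hr ((n : ℝ) + s * p) fun _ => 1
  rw [finrank_euclideanSpace_fin, sub_add_cancel_left,
    ← ENNReal.ofReal_toReal (setLIntegral_compl_ball_one_div_rpow_lt_top volume hfin).ne,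
    ← exteriorKernelIntegral, ← ENNReal.ofReal_mul (by positivity)] at hscale
  simp only [tailIntegral, abs_of_nonneg hc, ← mul_one_div (c ^ (p - 1)),
    ENNReal.ofReal_mul (Real.rpow_nonneg hc (p - 1))]
  rw [lintegral_const_mul' _ _ ENNReal.ofReal_ne_top, hscale, ← ENNReal.ofReal_mul (by positivity)]
  congr 1
  ring

theorem add_rpow_le {a b q : ℝ} (ha : 0 ≤ a) (hb : 0 ≤ b) (hq : 0 ≤ q) :
    (a + b) ^ q ≤ 2 ^ q * (a ^ q + b ^ q) := by
  wlog h : a ≤ b generalizing a b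
  · rw [add_comm a, add_comm (a ^ q)]
    exact this hb ha (le_of_not_ge h)
  calc (a + b) ^ q ≤ (2 * b) ^ q := by gcongr; linarith
    _ = 2 ^ q * b ^ q := Real.mul_rpow (by norm_num) hb
    _ ≤ 2 ^ q * (a ^ q + b ^ q) := by gcongr; exact le_add_of_nonneg_left (by positivity)

theorem tailIntegral_le_add (hp : 1 ≤ p) {w a b : E n → ℝ} (ha : Measurable a)
    (h : ∀ x, |w x| ≤ |a x| + |b x|) (x₀ : E n) (r : ℝ) :
    tailIntegral s p w x₀ r
      ≤ ENNReal.ofReal (2 ^ (p - 1)) * (tailIntegral s p a x₀ r + tailIntegral s p b x₀ r) := by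
  have hp1 : 0 ≤ p - 1 := by linarith
  rw [tailIntegral, tailIntegral, tailIntegral, ← lintegral_add_left (by fun_prop),
    ← lintegral_const_mul' _ _ ENNReal.ofReal_ne_top]
  refine lintegral_mono fun x => ?_
  rw [← ENNReal.ofReal_add (by positivity) (by positivity), ← ENNReal.ofReal_mul (by positivity),
    ← add_div, ← mul_div_assoc]
  refine ENNReal.ofReal_le_ofReal ?_
  gcongr
  exact (Real.rpow_le_rpow (abs_nonneg _) (h x) hp1).trans
    (add_rpow_le (abs_nonneg _) (abs_nonneg _) hp1)

theorem one_add_norm_le_mul_norm_sub {F : Type*} [SeminormedAddCommGroup F] {x x₀ : F} {r : ℝ}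
    (hr : 0 < r) (hx : r ≤ ‖x - x₀‖) : 1 + ‖x‖ ≤ ((1 + ‖x₀‖) / r + 1) * ‖x - x₀‖ := by
  have hcenter : 1 + ‖x₀‖ ≤ (1 + ‖x₀‖) / r * ‖x - x₀‖ := by
    rw [div_mul_eq_mul_div, le_div_iff₀ hr]
    gcongr
  linarith [norm_le_norm_add_norm_sub' x x₀]

theorem tailIntegral_lt_top (hs : 0 ≤ s) (hp : 0 ≤ p) {u : E n → ℝ} (hu : MemWeightedL s p u)
    (x₀ : E n) {r : ℝ} (hr : 0 < r) : tailIntegral s p u x₀ r < ∞ := by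
  have : 0 ≤ (n : ℝ) + s * p := by positivity
  set C : ℝ := (1 + ‖x₀‖) / r + 1
  refine lt_of_le_of_lt ?_ (ENNReal.mul_lt_top (ENNReal.ofReal_lt_top
    (r := C ^ ((n : ℝ) + s * p))) hu.2)
  rw [← lintegral_const_mul' _ _ ENNReal.ofReal_ne_top]
  refine (setLIntegral_mono_ae' measurableSet_ball.compl (.of_forall fun x hx => ?_)).trans
    (setLIntegral_le_lintegral _ _)
  have hrx : r ≤ ‖x - x₀‖ := by simpa [dist_eq_norm] using hx
  have hx0 : 0 < ‖x - x₀‖ := by linarith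
  rw [← ENNReal.ofReal_mul (by positivity)]
  refine ENNReal.ofReal_le_ofReal ?_
  rw [← mul_div_assoc, div_le_div_iff₀ (by positivity) (by positivity)]
  calc |u x| ^ (p - 1) * (1 + ‖x‖) ^ ((n : ℝ) + s * p)
      ≤ |u x| ^ (p - 1) * (C * ‖x - x₀‖) ^ ((n : ℝ) + s * p) := by
        gcongr
        exact one_add_norm_le_mul_norm_sub hr hrx
    _ = C ^ ((n : ℝ) + s * p) * |u x| ^ (p - 1) * ‖x - x₀‖ ^ ((n : ℝ) + s * p) := by
        rw [Real.mul_rpow (by positivity) hx0.le]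
        ring

theorem tailIntegral_le_of_ae_eq_zero (hp : p ≠ 1) {w : E n → ℝ} {x₀ : E n} {r ρ : ℝ}
    (h : ∀ᵐ x ∂volume.restrict (ball x₀ ρ), w x = 0) :
    tailIntegral s p w x₀ r ≤ tailIntegral s p w x₀ ρ := by
  have hsub : (ball x₀ r)ᶜ ⊆ ball x₀ ρ ∪ (ball x₀ ρ)ᶜ :=
    (subset_univ _).trans_eq (union_compl_self _).symm
  have hzero : ∫⁻ x in ball x₀ ρ,
      ENNReal.ofReal (|w x| ^ (p - 1) / ‖x - x₀‖ ^ ((n : ℝ) + s * p)) = 0 := by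
    refine (lintegral_congr_ae ?_).trans lintegral_zero
    filter_upwards [h] with x hx
    rw [hx, abs_zero, Real.zero_rpow (sub_ne_zero.2 hp), zero_div, ENNReal.ofReal_zero]
  calc tailIntegral s p w x₀ r ≤ _ := lintegral_mono_set hsub
    _ ≤ _ := lintegral_union_le _ _ _
    _ = tailIntegral s p w x₀ ρ := by rw [hzero, zero_add, tailIntegral]

end Tail

/-! ### Improvement of the supremum -/

section Growth

variable {f : E n → ℝ} {x₀ : E n} {ρ k K b Λ : ℝ}

theorem tailIntegral_posPart_sub_le (hs : 0 < s) (hp : 1 < p) (hρ : 0 < ρ) (hK : 0 ≤ K) {M : ℝ}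
    (hM : ∀ᵐ x ∂volume.restrict (ball x₀ ρ), f x ≤ M)
    (htail : tailIntegral s p (fun x => (f x - M)⁺) x₀ ρ
      ≤ ENNReal.ofReal (K ^ (p - 1) * ρ ^ (-(s * p)))) :
    tailIntegral s p (fun x => (f x - (M - K))⁺) x₀ (ρ / 4)
      ≤ ENNReal.ofReal (2 ^ (p - 1) * (4 ^ (s * p) * exteriorKernelIntegral n (s * p) + 1)
        * K ^ (p - 1) * ρ ^ (-(s * p))) := by
  have hI := exteriorKernelIntegral_nonneg n (s * p)
  have hsplit (x : E n) : |(f x - (M - K))⁺| ≤ |K| + |(f x - M)⁺| := by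
    rw [abs_of_nonneg (posPart_nonneg _), abs_of_nonneg (posPart_nonneg _), abs_of_nonneg hK]
    exact sup_le (by linarith [le_posPart (f x - M)]) (add_nonneg hK (posPart_nonneg _))
  have hfar : tailIntegral s p (fun x => (f x - M)⁺) x₀ (ρ / 4)
      ≤ tailIntegral s p (fun x => (f x - M)⁺) x₀ ρ := by
    refine tailIntegral_le_of_ae_eq_zero hp.ne' ?_
    filter_upwards [hM] with x hx
    exact posPart_eq_zero.2 (by linarith)
  calc tailIntegral s p (fun x => (f x - (M - K))⁺) x₀ (ρ / 4)
      ≤ ENNReal.ofReal (2 ^ (p - 1)) * (tailIntegral s p (fun _ => K) x₀ (ρ / 4)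
          + tailIntegral s p (fun x => (f x - M)⁺) x₀ (ρ / 4)) :=
        tailIntegral_le_add hp.le measurable_const hsplit x₀ (ρ / 4)
    _ ≤ ENNReal.ofReal (2 ^ (p - 1)) *
          (ENNReal.ofReal (K ^ (p - 1) * exteriorKernelIntegral n (s * p)
              * (ρ / 4) ^ (-(s * p)))
            + ENNReal.ofReal (K ^ (p - 1) * ρ ^ (-(s * p)))) := by
        rw [tailIntegral_const hs (by linarith) hK x₀ (by positivity)]
        gcongr
        exact hfar.trans htail
    _ = _ := by
        rw [← ENNReal.ofReal_add (by positivity) (by positivity),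
          ← ENNReal.ofReal_mul (by positivity), Real.div_rpow hρ.le (by norm_num),
          Real.rpow_neg (x := 4) (by norm_num)]
        congr 1
        field_simp

theorem excess_le_of_ae_le (hp : 0 ≤ p) (hρ : 0 < ρ) (hK : 0 ≤ K)
    (hM : ∀ᵐ x ∂volume.restrict (ball x₀ ρ), f x ≤ k + K) :
    excess p f k (volume.restrict (ball x₀ ρ))
      ≤ ENNReal.ofReal (K ^ p * (unitBallVolume n * ρ ^ n)) := by
  rw [ENNReal.ofReal_mul (by positivity), ← volume_ball_eq x₀ hρ, ← setLIntegral_const]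
  refine lintegral_mono_ae ?_
  filter_upwards [hM] with x hx
  exact ENNReal.ofReal_le_ofReal
    (Real.rpow_le_rpow (posPart_nonneg _) (sup_le (by linarith) hK) hp)

theorem excess_le_rpow_mul_excess_one {X : Type*} [MeasurableSpace X] {μ : Measure X} {g : X → ℝ}
    (hp : 1 ≤ p) (hK : 0 ≤ K) (hM : ∀ᵐ x ∂μ, g x ≤ k + K) :
    excess p g k μ ≤ ENNReal.ofReal (K ^ (p - 1)) * excess 1 g k μ := by
  rw [excess, excess, ← lintegral_const_mul' _ _ ENNReal.ofReal_ne_top]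
  refine lintegral_mono_ae ?_
  filter_upwards [hM] with x hx
  have hle : (g x - k)⁺ ≤ K := sup_le (by linarith) hK
  rw [← ENNReal.ofReal_mul (by positivity), Real.rpow_one]
  refine ENNReal.ofReal_le_ofReal ?_
  calc (g x - k)⁺ ^ p = (g x - k)⁺ ^ (p - 1) * (g x - k)⁺ := by
        rw [← Real.rpow_add_one' (posPart_nonneg _) (by linarith), sub_add_cancel]
    _ ≤ K ^ (p - 1) * (g x - k)⁺ := by
        have := posPart_nonneg (g x - k)
        gcongr

theorem SuperlevelCaccioppoli.interaction_le (hp : 1 ≤ p) (hH : 0 ≤ H) (hΛ : 0 ≤ Λ)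
    (hf : SuperlevelCaccioppoli s p d H lam f x₀ ρ) (hρ : 0 < ρ) (hK : 0 < K)
    (hM : ∀ᵐ x ∂volume.restrict (ball x₀ ρ), f x ≤ k + K)
    (hd : ρ ^ (lam + s * p) * d ^ p ≤ Λ * K ^ p)
    (htail : tailIntegral s p (fun x => (f x - k)⁺) x₀ (ρ / 2)
      ≤ ENNReal.ofReal (Λ * K ^ (p - 1) * ρ ^ (-(s * p)))) :
    interaction s p (fun x => (f x - k)⁺) (fun x => (f x - k)⁻) (ball x₀ (ρ / 2))
      ≤ ENNReal.ofReal (H * ((Λ + 2 ^ p + 2 ^ ((n : ℝ) + s * p) * Λ)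
        * (unitBallVolume n * ρ ^ n) * K ^ p * ρ ^ (-(s * p)))) := by
  have hV := unitBallVolume_pos n
  have hhalf : ρ - ρ / 2 = ρ / 2 := by ring
  have hdatum : ENNReal.ofReal (ρ ^ lam * d ^ p) * volume ({x | k < f x} ∩ ball x₀ ρ)
      ≤ ENNReal.ofReal (Λ * K ^ p * ρ ^ (-(s * p)) * (unitBallVolume n * ρ ^ n)) := by
    rw [ENNReal.ofReal_mul (p := Λ * K ^ p * ρ ^ (-(s * p))) (by positivity),
      ← volume_ball_eq x₀ hρ]
    refine mul_le_mul' (ENNReal.ofReal_le_ofReal ?_) (measure_mono inter_subset_right)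
    calc ρ ^ lam * d ^ p = ρ ^ (lam + s * p) * d ^ p * ρ ^ (-(s * p)) := by
          rw [mul_right_comm, ← Real.rpow_add hρ, add_neg_cancel_right]
      _ ≤ Λ * K ^ p * ρ ^ (-(s * p)) := by gcongr
  have hlocal : ENNReal.ofReal (ρ ^ ((1 - s) * p) / (ρ - ρ / 2) ^ p)
      * excess p f k (volume.restrict (ball x₀ ρ))
      ≤ ENNReal.ofReal (2 ^ p * ρ ^ (-(s * p)) * (K ^ p * (unitBallVolume n * ρ ^ n))) := by
    rw [ENNReal.ofReal_mul (by positivity), hhalf, Real.div_rpow hρ.le (by norm_num),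
      show (1 - s) * p = p + -(s * p) by ring, Real.rpow_add hρ]
    refine mul_le_mul' (ENNReal.ofReal_le_ofReal (le_of_eq ?_))
      (excess_le_of_ae_le (by linarith) hρ hK.le hM)
    field_simp
  have hnonlocal : ENNReal.ofReal (ρ ^ ((n : ℝ) + s * p) / (ρ - ρ / 2) ^ ((n : ℝ) + s * p))
      * excess 1 f k (volume.restrict (ball x₀ ρ))
      * tailIntegral s p (fun x => (f x - k)⁺) x₀ (ρ / 2)
      ≤ ENNReal.ofReal (2 ^ ((n : ℝ) + s * p) * (K ^ (1 : ℝ) * (unitBallVolume n * ρ ^ n))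
        * (Λ * K ^ (p - 1) * ρ ^ (-(s * p)))) := by
    rw [ENNReal.ofReal_mul (by positivity), ENNReal.ofReal_mul (by positivity), hhalf,
      Real.div_rpow hρ.le (by norm_num)]
    refine mul_le_mul' (mul_le_mul' (ENNReal.ofReal_le_ofReal (le_of_eq ?_))
      (excess_le_of_ae_le zero_le_one hρ hK.le hM)) htail
    field_simp
  refine (le_add_self.trans (hf (ρ / 2) ρ (by positivity) (by linarith) le_rfl k)).trans ?_
  rw [ENNReal.ofReal_mul hH]
  gcongr
  refine (add_le_add (add_le_add hdatum hlocal) hnonlocal).trans_eq ?_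
  rw [← ENNReal.ofReal_add (by positivity) (by positivity),
    ← ENNReal.ofReal_add (by positivity) (by positivity), Real.rpow_sub_one hK.ne', Real.rpow_one]
  congr 1
  field_simp

/-- This is where the interaction term of the strong Caccioppoli inequality is used: it replaces
the isoperimetric inequality between level sets in the local theory. -/
theorem SuperlevelCaccioppoli.excess_one_le (hs : 0 ≤ s) (hp : 1 ≤ p) (hH : 0 ≤ H) (hΛ : 0 ≤ Λ)
    (hf : SuperlevelCaccioppoli s p d H lam f x₀ ρ) (hfm : Measurable f) (hρ : 0 < ρ) (hK : 0 < K)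
    (hb : 0 < b) (hM : ∀ᵐ x ∂volume.restrict (ball x₀ ρ), f x ≤ k + K)
    (hlow : ENNReal.ofReal (unitBallVolume n * (ρ / 2) ^ n / 2)
      ≤ volume ({x | f x ≤ k - b} ∩ ball x₀ (ρ / 2)))
    (hd : ρ ^ (lam + s * p) * d ^ p ≤ Λ * K ^ p)
    (htail : tailIntegral s p (fun x => (f x - k)⁺) x₀ (ρ / 2)
      ≤ ENNReal.ofReal (Λ * K ^ (p - 1) * ρ ^ (-(s * p)))) :
    excess 1 f k (volume.restrict (ball x₀ (ρ / 2)))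
      ≤ ENNReal.ofReal (H * (Λ + 2 ^ p + 2 ^ ((n : ℝ) + s * p) * Λ) * 2 ^ (n + 1)
        * ρ ^ n * (K ^ p / b ^ (p - 1))) := by
  have hV := unitBallVolume_pos n
  have hc : 0 < b ^ (p - 1) / ρ ^ ((n : ℝ) + s * p) * (unitBallVolume n * (ρ / 2) ^ n / 2) := by
    positivity
  have hE := (ofReal_mul_excess_le_interaction hs hp hfm hρ hb hlow).trans
    (hf.interaction_le hp hH hΛ hρ hK hM hd htail)
  rw [mul_comm, ← ENNReal.le_div_iff_mul_le (Or.inl (ENNReal.ofReal_pos.2 hc).ne')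
    (Or.inl ENNReal.ofReal_ne_top), ← ENNReal.ofReal_div_of_pos hc] at hE
  refine hE.trans_eq ?_
  congr 1
  rw [Real.rpow_add hρ, Real.rpow_natCast, Real.rpow_neg hρ.le, div_pow]
  field_simp
  ring

theorem SuperlevelCaccioppoli.excess_le_of_half_volume_le (hs : 0 ≤ s) (hp : 1 ≤ p) (hH : 0 ≤ H)
    (hΛ : 0 ≤ Λ) (hf : SuperlevelCaccioppoli s p d H lam f x₀ ρ) (hfm : Measurable f)
    (hρ : 0 < ρ) (hK : 0 < K) (hb : 0 < b) (hM : ∀ᵐ x ∂volume.restrict (ball x₀ ρ), f x ≤ k + K)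
    (hlow : ENNReal.ofReal (unitBallVolume n * (ρ / 2) ^ n / 2)
      ≤ volume ({x | f x ≤ k - b} ∩ ball x₀ (ρ / 2)))
    (hd : ρ ^ (lam + s * p) * d ^ p ≤ Λ * K ^ p)
    (htail : tailIntegral s p (fun x => (f x - k)⁺) x₀ (ρ / 2)
      ≤ ENNReal.ofReal (Λ * K ^ (p - 1) * ρ ^ (-(s * p)))) :
    excess p f k (volume.restrict (ball x₀ (ρ / 2)))
      ≤ ENNReal.ofReal (H * (Λ + 2 ^ p + 2 ^ ((n : ℝ) + s * p) * Λ) * 2 ^ (n + 1)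
        * (K / b) ^ (p - 1) * K ^ p * ρ ^ n) := by
  have hM' := ae_restrict_of_ae_restrict_of_subset
    (ball_subset_ball (by linarith : ρ / 2 ≤ ρ)) hM
  refine (excess_le_rpow_mul_excess_one hp hK.le hM').trans <| (mul_le_mul_right
    (hf.excess_one_le hs hp hH hΛ hfm hρ hK hb hM hlow hd htail) _).trans_eq ?_
  rw [← ENNReal.ofReal_mul (by positivity), Real.div_rpow hK.le hb.le]
  congr 1
  ring

/-- The interaction with the large set where `f ≤ k - b` makes the excess over `k` small enough for
the De Giorgi iteration to start. -/
theorem exists_ae_le_add_half (hs : 0 < s) (hs1 : s ≤ 1) (hp : 1 < p) (hH : 0 < H)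
    (hlam : 0 ≤ lam) (n : ℕ) (hΛ : 0 ≤ Λ) :
    ∃ ε : ℝ, 0 < ε ∧ ∀ d : ℝ, 0 ≤ d → ∀ f : E n → ℝ, Measurable f →
      ∀ (x₀ : E n) (ρ : ℝ), 0 < ρ → SuperlevelCaccioppoli s p d H lam f x₀ ρ →
      ∀ k K b : ℝ, 0 < K → K ≤ ε * b →
      (∀ᵐ x ∂volume.restrict (ball x₀ ρ), f x ≤ k + K) →
      ENNReal.ofReal (unitBallVolume n * (ρ / 2) ^ n / 2)
        ≤ volume ({x | f x ≤ k - b} ∩ ball x₀ (ρ / 2)) →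
      ρ ^ (lam + s * p) * d ^ p ≤ Λ * K ^ p →
      tailIntegral s p (fun x => (f x - k)⁺) x₀ (ρ / 4)
        ≤ ENNReal.ofReal (Λ * K ^ (p - 1) * ρ ^ (-(s * p))) →
      ∀ᵐ x ∂volume.restrict (ball x₀ (ρ / 4)), f x ≤ k + K / 2 := by
  have hp1 : 0 < p - 1 := by linarith
  obtain ⟨θ, hθ, hiter⟩ := exists_excess_threshold hs hs1 hp.le hH hlam n
    (by positivity : 0 ≤ 2 ^ p * Λ)
  set C : ℝ := H * (Λ + 2 ^ p + 2 ^ ((n : ℝ) + s * p) * Λ) * 2 ^ (n + 1)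
  have hC0 : 0 < C := by positivity
  set η : ℝ := θ / (2 ^ p * 2 ^ n * C) with hη
  refine ⟨η ^ (p - 1)⁻¹, by positivity, fun d hd f hfm x₀ ρ hρ hf k K b hK hKb hM hlow hdK
    htail => ?_⟩
  have hb : 0 < b := pos_of_mul_pos_right (hK.trans_le hKb) (by positivity)
  have hratio : (K / b) ^ (p - 1) ≤ η := by
    rw [← Real.rpow_inv_rpow (by positivity : 0 ≤ η) hp1.ne']
    gcongr
    exact (div_le_iff₀ hb).2 hKb
  have htail' : tailIntegral s p (fun x => (f x - k)⁺) x₀ (ρ / 2)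
      ≤ ENNReal.ofReal (Λ * K ^ (p - 1) * ρ ^ (-(s * p))) :=
    (tailIntegral_posPart_sub_anti hp.le f le_rfl x₀ (by linarith)).trans htail
  have hexcess : excess p f k (volume.restrict (ball x₀ (ρ / 2)))
      ≤ ENNReal.ofReal (θ * (K / 2) ^ p * (ρ / 2) ^ n) := by
    refine (hf.excess_le_of_half_volume_le hs.le hp.le hH.le hΛ hfm hρ hK hb hM hlow hdK
      htail').trans (ENNReal.ofReal_le_ofReal ?_)
    calc C * (K / b) ^ (p - 1) * K ^ p * ρ ^ n ≤ C * η * K ^ p * ρ ^ n := by gcongr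
      _ = θ * (K / 2) ^ p * (ρ / 2) ^ n := by
          rw [hη, Real.div_rpow hK.le (by norm_num), div_pow]
          field_simp
  rw [show ρ / 4 = ρ / 2 / 2 by ring] at htail ⊢
  have hhalf (q : ℝ) : K ^ q = 2 ^ q * (K / 2) ^ q := by
    rw [← Real.mul_rpow (by norm_num) (by positivity), mul_div_cancel₀ K two_ne_zero]
  refine hiter d hd f hfm x₀ (ρ / 2) (by positivity) (hf.mono (by linarith)) k (K / 2)
    (by positivity) ?_ (htail.trans (ENNReal.ofReal_le_ofReal ?_)) hexcess
  · calc (ρ / 2) ^ (lam + s * p) * d ^ p ≤ ρ ^ (lam + s * p) * d ^ p := by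
          gcongr
          linarith
      _ ≤ 2 ^ p * Λ * (K / 2) ^ p := by rwa [mul_comm (2 ^ p), mul_assoc, ← hhalf]
  · rw [hhalf (p - 1), mul_left_comm, ← mul_assoc]
    gcongr ?_ * _ * ?_
    · gcongr <;> linarith
    · exact Real.rpow_le_rpow_of_nonpos (by positivity) (by linarith) (by nlinarith)

theorem exists_ae_le_sub_of_half_volume_le (hs : 0 < s) (hs1 : s ≤ 1) (hp : 1 < p) (hH : 0 < H)
    (hlam : 0 ≤ lam) (n : ℕ) :
    ∃ δ : ℝ, 0 < δ ∧ δ ≤ 1 / 4 ∧ ∀ d : ℝ, 0 ≤ d → ∀ f : E n → ℝ, Measurable f →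
      ∀ (x₀ : E n) (ρ : ℝ), 0 < ρ → SuperlevelCaccioppoli s p d H lam f x₀ ρ →
      ∀ M ω : ℝ, 0 < ω → (∀ᵐ x ∂volume.restrict (ball x₀ ρ), f x ≤ M) →
      ENNReal.ofReal (unitBallVolume n * (ρ / 2) ^ n / 2)
        ≤ volume ({x | f x ≤ M - ω / 2} ∩ ball x₀ (ρ / 2)) →
      ρ ^ (lam + s * p) * d ^ p ≤ (δ * ω) ^ p →
      tailIntegral s p (fun x => (f x - M)⁺) x₀ ρ
        ≤ ENNReal.ofReal ((δ * ω) ^ (p - 1) * ρ ^ (-(s * p))) →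
      ∀ᵐ x ∂volume.restrict (ball x₀ (ρ / 4)), f x ≤ M - δ * ω / 2 := by
  have hI := exteriorKernelIntegral_nonneg n (s * p)
  set Λ : ℝ := 2 ^ (p - 1) * (4 ^ (s * p) * exteriorKernelIntegral n (s * p) + 1)
  have hΛ1 : 1 ≤ Λ := one_le_mul_of_one_le_of_one_le
    (Real.one_le_rpow one_le_two (by linarith)) (le_add_of_nonneg_left (by positivity))
  obtain ⟨ε, hε, hstep⟩ := exists_ae_le_add_half hs hs1 hp hH hlam n (zero_le_one.trans hΛ1)
  refine ⟨min (1 / 4) (ε / 4), by positivity, min_le_left _ _, ?_⟩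
  set δ : ℝ := min (1 / 4) (ε / 4)
  intro d hd f hfm x₀ ρ hρ hf M ω hω hM hlow hdω htail
  have hδ : δ ≤ 1 / 4 := min_le_left _ _
  have hδε : δ ≤ ε / 4 := min_le_right _ _
  have hK : 0 < δ * ω := by positivity
  have hsub : {x | f x ≤ M - ω / 2} ⊆ {x | f x ≤ M - δ * ω - ω / 4} := by
    intro x (hx : f x ≤ M - ω / 2)
    change f x ≤ M - δ * ω - ω / 4
    nlinarith
  have hgrowth := hstep d hd f hfm x₀ ρ hρ hf (M - δ * ω) (δ * ω) (ω / 4) hK (by nlinarith)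
    (by simpa only [sub_add_cancel] using hM)
    (hlow.trans (measure_mono (inter_subset_inter_left _ hsub)))
    (hdω.trans (le_mul_of_one_le_left (by positivity) hΛ1))
    (tailIntegral_posPart_sub_le hs hp hρ hK.le hM htail)
  filter_upwards [hgrowth] with x hx
  linarith

end Growth

theorem SuperlevelCaccioppoli.exists_ae_le (hs : 0 < s) (hs1 : s ≤ 1) (hp : 1 < p) (hH : 0 < H)
    (hlam : 0 ≤ lam) (hd : 0 ≤ d) {f : E n → ℝ} (hfm : Measurable f) {x₀ : E n} {R : ℝ}
    (hR : 0 < R) (hf : SuperlevelCaccioppoli s p d H lam f x₀ R)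
    (htail : tailIntegral s p f x₀ (R / 2) < ∞)
    (hLp : ∫⁻ x in ball x₀ R, ENNReal.ofReal (|f x| ^ p) < ∞) :
    ∃ K, ∀ᵐ x ∂volume.restrict (ball x₀ (R / 2)), f x ≤ K := by
  have hp1 : 0 < p - 1 := by linarith
  obtain ⟨θ, hθ, hiter⟩ := exists_excess_threshold hs hs1 hp.le hH hlam n zero_le_one
  have hpos (x : E n) : (f x - 0)⁺ ≤ |f x| := by
    rw [sub_zero]
    exact sup_le (le_abs_self _) (abs_nonneg _)
  have htail0 : tailIntegral s p (fun x => (f x - 0)⁺) x₀ (R / 2) < ∞ :=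
    (tailIntegral_mono hp.le (fun x => (abs_of_nonneg (posPart_nonneg _)).trans_le (hpos x))
      x₀ le_rfl).trans_lt htail
  have hexcess0 : excess p f 0 (volume.restrict (ball x₀ R)) < ∞ :=
    (lintegral_mono fun x => ENNReal.ofReal_le_ofReal
      (Real.rpow_le_rpow (posPart_nonneg _) (hpos x) (by linarith))).trans_lt hLp
  obtain ⟨K, hK0, hKd, hKtail, hKexcess⟩ := ((Filter.eventually_gt_atTop (0 : ℝ)).and <|
    ((tendsto_rpow_atTop (by linarith : 0 < p)).eventually_ge_atTop
      (R ^ (lam + s * p) * d ^ p)).and <|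
    ((tendsto_rpow_atTop hp1).eventually_ge_atTop
      ((tailIntegral s p (fun x => (f x - 0)⁺) x₀ (R / 2)).toReal / R ^ (-(s * p)))).and <|
    (tendsto_rpow_atTop (by linarith : 0 < p)).eventually_ge_atTop
      ((excess p f 0 (volume.restrict (ball x₀ R))).toReal / (θ * R ^ n))).exists
  rw [div_le_iff₀ (by positivity)] at hKtail hKexcess
  refine ⟨0 + K, hiter d hd f hfm x₀ R hR hf 0 K hK0 (by rwa [one_mul]) ?_ ?_⟩
  · rwa [one_mul, ENNReal.le_ofReal_iff_toReal_le htail0.ne (by positivity)]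
  · rw [ENNReal.le_ofReal_iff_toReal_le hexcess0.ne (by positivity)]
    linarith

/-! ### Decay of the oscillation -/

/-- The inductive control of the oscillation of `u`: it lies between `m` and `M` on `B_ρ(x₀)`, and
leaves this interval by a controlled amount on `B_R(x₀)`. The last two fields say that `ρ` is so
small that the lower order terms and the tail, bounded in terms of `L` on `B_R(x₀)`, are small
relative to `ω`. -/
structure OscillationBound (s p α δ L R : ℝ) (u : E n → ℝ) (x₀ : E n) (ω ρ m M : ℝ) : Prop where
  radius_pos : 0 < ρ
  radius_le : ρ ≤ R
  width_pos : 0 < ω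
  lower : -L ≤ m
  upper : M ≤ L
  width : M - m = ω
  near : ∀ᵐ x ∂volume.restrict (ball x₀ ρ), m ≤ u x ∧ u x ≤ M
  far : ∀ᵐ x ∂volume.restrict (ball x₀ R), ρ ≤ ‖x - x₀‖ →
    m - u x ≤ ω * ((4 * (‖x - x₀‖ / ρ)) ^ α - 1) ∧ u x - M ≤ ω * ((4 * (‖x - x₀‖ / ρ)) ^ α - 1)
  datum_small : L ^ p * ρ ^ (s * p) ≤ (δ * ω) ^ p * R ^ (s * p)
  tail_small : 2 ^ p * (1 + exteriorKernelIntegral n (s * p)) * L ^ (p - 1) * ρ ^ (s * p)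
    ≤ (δ * ω) ^ (p - 1) * R ^ (s * p)

theorem one_le_four_mul_div_rpow {α ρ t : ℝ} (hα : 0 ≤ α) (hρ : 0 < ρ) (ht : ρ / 4 ≤ t) :
    1 ≤ (4 * (t / ρ)) ^ α := by
  refine Real.one_le_rpow ?_ hα
  rw [← mul_div_assoc, le_div_iff₀ hρ]
  linarith

theorem mul_div_four_rpow_le {α q β ε ρ X Y : ℝ} (hαq : α * q ≤ β) (hε : 0 ≤ ε) (hρ : 0 ≤ ρ)
    (hX : 0 ≤ X) (h : X * ρ ^ β ≤ ε ^ q * Y) :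
    X * (ρ / 4) ^ β ≤ (4 ^ (-α) * ε) ^ q * Y :=
  calc X * (ρ / 4) ^ β = 4 ^ (-β) * (X * ρ ^ β) := by
        rw [Real.div_rpow hρ (by norm_num), Real.rpow_neg (by norm_num)]
        ring
    _ ≤ 4 ^ (-(α * q)) * (X * ρ ^ β) := by
        gcongr
        norm_num
    _ ≤ 4 ^ (-(α * q)) * (ε ^ q * Y) := by gcongr
    _ = (4 ^ (-α) * ε) ^ q * Y := by
        rw [Real.mul_rpow (by positivity) hε, ← Real.rpow_mul (by norm_num), neg_mul, mul_assoc]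

namespace OscillationBound

variable {α δ L R : ℝ} {u : E n → ℝ} {x₀ : E n} {ω ρ m M : ℝ}

theorem bound_pos (h : OscillationBound s p α δ L R u x₀ ω ρ m M) : 0 < L := by
  linarith [h.lower, h.upper, h.width, h.width_pos]

theorem outer_radius_pos (h : OscillationBound s p α δ L R u x₀ ω ρ m M) : 0 < R :=
  h.radius_pos.trans_le h.radius_le

theorem neg (h : OscillationBound s p α δ L R u x₀ ω ρ m M) :
    OscillationBound s p α δ L R (fun x => -u x) x₀ ω ρ (-M) (-m) where
  radius_pos := h.radius_pos
  radius_le := h.radius_le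
  width_pos := h.width_pos
  lower := neg_le_neg h.upper
  upper := by linarith [h.lower]
  width := by linarith [h.width]
  near := by
    filter_upwards [h.near] with x hx
    exact ⟨neg_le_neg hx.2, neg_le_neg hx.1⟩
  far := by
    filter_upwards [h.far] with x hx hxρ
    have := hx hxρ
    constructor <;> linarith
  datum_small := h.datum_small
  tail_small := h.tail_small

/-- The profile `(4t/ρ)^α` is chosen so that shrinking `ρ` by `4` and `ω` by `4^{-α}` costs exactly
the amount by which `M` is lowered. -/
theorem far_shrink_upper (hα : 0 ≤ α) (h : OscillationBound s p α δ L R u x₀ ω ρ m M) :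
    ∀ᵐ x ∂volume.restrict (ball x₀ R), ρ / 4 ≤ ‖x - x₀‖ →
      m - u x ≤ 4 ^ (-α) * ω * ((4 * (‖x - x₀‖ / (ρ / 4))) ^ α - 1) ∧
      u x - (M - (1 - 4 ^ (-α)) * ω)
        ≤ 4 ^ (-α) * ω * ((4 * (‖x - x₀‖ / (ρ / 4))) ^ α - 1) := by
  have hρ := h.radius_pos
  have hω := h.width_pos
  have hα1 : (4 : ℝ) ^ (-α) ≤ 1 := Real.rpow_le_one_of_one_le_of_nonpos (by norm_num) (by linarith)
  have hdrop : 0 ≤ (1 - (4 : ℝ) ^ (-α)) * ω := mul_nonneg (by linarith) hω.le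
  have hnear : ∀ᵐ x ∂volume.restrict (ball x₀ R), x ∈ ball x₀ ρ → m ≤ u x ∧ u x ≤ M :=
    ae_restrict_of_ae ((ae_restrict_iff' measurableSet_ball).1 h.near)
  filter_upwards [h.far, hnear] with x hfar hnear hx
  have hprofile : 4 ^ (-α) * ω * ((4 * (‖x - x₀‖ / (ρ / 4))) ^ α - 1)
      = ω * (4 * (‖x - x₀‖ / ρ)) ^ α - 4 ^ (-α) * ω := by
    have hcancel : (4 : ℝ) ^ (-α) * 4 ^ α = 1 := by
      rw [← Real.rpow_add (by norm_num), neg_add_cancel, Real.rpow_zero]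
    rw [show 4 * (‖x - x₀‖ / (ρ / 4)) = 4 * (4 * (‖x - x₀‖ / ρ)) by field_simp,
      Real.mul_rpow (by norm_num) (by positivity)]
    linear_combination ω * (4 * (‖x - x₀‖ / ρ)) ^ α * hcancel
  rw [hprofile]
  by_cases hxρ : ρ ≤ ‖x - x₀‖
  · have := hfar hxρ
    constructor <;> linarith
  · have hin := hnear (by rw [mem_ball, dist_eq_norm]; linarith)
    have hgrow := le_mul_of_one_le_right hω.le (one_le_four_mul_div_rpow hα hρ hx)
    constructor <;> linarith

theorem shrink_upper (hp : 1 ≤ p) (hα : 0 ≤ α) (hαs : α ≤ s) (hδ : 0 ≤ δ)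
    (h : OscillationBound s p α δ L R u x₀ ω ρ m M)
    (hu : ∀ᵐ x ∂volume.restrict (ball x₀ (ρ / 4)), u x ≤ M - (1 - 4 ^ (-α)) * ω) :
    OscillationBound s p α δ L R u x₀ (4 ^ (-α) * ω) (ρ / 4) m (M - (1 - 4 ^ (-α)) * ω) := by
  have hρ := h.radius_pos
  have hω := h.width_pos
  have hL := h.bound_pos
  have hI := exteriorKernelIntegral_nonneg n (s * p)
  have hα1 : (4 : ℝ) ^ (-α) ≤ 1 := Real.rpow_le_one_of_one_le_of_nonpos (by norm_num) (by linarith)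
  have hdrop : 0 ≤ (1 - (4 : ℝ) ^ (-α)) * ω := mul_nonneg (by linarith) hω.le
  have hαp : α * p ≤ s * p := by gcongr
  refine ⟨by positivity, by linarith [h.radius_le], by positivity, h.lower,
    by linarith [h.upper], by linarith [h.width], ?_, h.far_shrink_upper hα, ?_, ?_⟩
  · filter_upwards [hu, ae_restrict_of_ae_restrict_of_subset
      (ball_subset_ball (by linarith : ρ / 4 ≤ ρ)) h.near] with x hupper hnear
    exact ⟨hnear.1, hupper⟩
  · rw [mul_left_comm]
    exact mul_div_four_rpow_le hαp (by positivity) hρ.le (by positivity) h.datum_small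
  · rw [mul_left_comm]
    exact mul_div_four_rpow_le (by linarith) (by positivity) hρ.le (by positivity) h.tail_small

theorem setLIntegral_annulus_le (hp : 1 ≤ p) (hα : 0 ≤ α) (hδ : 0 ≤ δ)
    (h : OscillationBound s p α δ L R u x₀ ω ρ m M)
    (hα' : ∫⁻ y in (ball (0 : E n) 1)ᶜ,
        ENNReal.ofReal (((4 * ‖y‖) ^ α - 1) ^ (p - 1) / ‖y‖ ^ ((n : ℝ) + s * p))
      ≤ ENNReal.ofReal (δ ^ (p - 1) / 2)) :
    ∫⁻ x in ball x₀ R ∩ (ball x₀ ρ)ᶜ,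
        ENNReal.ofReal (|(u x - M)⁺| ^ (p - 1) / ‖x - x₀‖ ^ ((n : ℝ) + s * p))
      ≤ ENNReal.ofReal ((δ * ω) ^ (p - 1) * ρ ^ (-(s * p)) / 2) := by
  have hρ := h.radius_pos
  have hω := h.width_pos
  have hscale := setLIntegral_compl_ball_kernel_eq volume x₀ hρ ((n : ℝ) + s * p)
    fun t => ((4 * t) ^ α - 1) ^ (p - 1)
  rw [finrank_euclideanSpace_fin, sub_add_cancel_left] at hscale
  calc ∫⁻ x in ball x₀ R ∩ (ball x₀ ρ)ᶜ,
        ENNReal.ofReal (|(u x - M)⁺| ^ (p - 1) / ‖x - x₀‖ ^ ((n : ℝ) + s * p))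
      ≤ ∫⁻ x in ball x₀ R ∩ (ball x₀ ρ)ᶜ, ENNReal.ofReal (ω ^ (p - 1)) *
          ENNReal.ofReal (((4 * (‖x - x₀‖ / ρ)) ^ α - 1) ^ (p - 1)
            / ‖x - x₀‖ ^ ((n : ℝ) + s * p)) := by
        refine setLIntegral_mono_ae' (measurableSet_ball.inter measurableSet_ball.compl) ?_
        filter_upwards [(ae_restrict_iff' measurableSet_ball).1 h.far] with x hfar hx
        have hxρ : ρ ≤ ‖x - x₀‖ := by simpa [dist_eq_norm] using hx.2
        have hone := one_le_four_mul_div_rpow hα hρ (by linarith : ρ / 4 ≤ ‖x - x₀‖)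
        have hle : (u x - M)⁺ ≤ ω * ((4 * (‖x - x₀‖ / ρ)) ^ α - 1) :=
          sup_le (hfar hx.1 hxρ).2 (mul_nonneg hω.le (by linarith))
        have hrpow := Real.rpow_le_rpow (posPart_nonneg _) hle (sub_nonneg.2 hp)
        rw [← ENNReal.ofReal_mul (by positivity), abs_of_nonneg (posPart_nonneg _),
          ← mul_div_assoc, ← Real.mul_rpow hω.le (by linarith)]
        gcongr
    _ ≤ ∫⁻ x in (ball x₀ ρ)ᶜ, ENNReal.ofReal (ω ^ (p - 1)) *
          ENNReal.ofReal (((4 * (‖x - x₀‖ / ρ)) ^ α - 1) ^ (p - 1)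
            / ‖x - x₀‖ ^ ((n : ℝ) + s * p)) := lintegral_mono_set inter_subset_right
    _ ≤ ENNReal.ofReal (ω ^ (p - 1)) *
          (ENNReal.ofReal (ρ ^ (-(s * p))) * ENNReal.ofReal (δ ^ (p - 1) / 2)) := by
        rw [lintegral_const_mul' _ _ ENNReal.ofReal_ne_top, hscale]
        gcongr
    _ = ENNReal.ofReal ((δ * ω) ^ (p - 1) * ρ ^ (-(s * p)) / 2) := by
        rw [← ENNReal.ofReal_mul (by positivity), ← ENNReal.ofReal_mul (by positivity),
          Real.mul_rpow hδ hω.le]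
        congr 1
        ring

theorem tailIntegral_outer_radius_le (hs : 0 < s) (hp : 1 ≤ p) (hum : Measurable u)
    (h : OscillationBound s p α δ L R u x₀ ω ρ m M)
    (htail : tailIntegral s p u x₀ R ≤ ENNReal.ofReal (L ^ (p - 1) * R ^ (-(s * p)))) :
    tailIntegral s p (fun x => (u x - M)⁺) x₀ R
      ≤ ENNReal.ofReal ((δ * ω) ^ (p - 1) * ρ ^ (-(s * p)) / 2) := by
  have hρ := h.radius_pos
  have hR := h.outer_radius_pos
  have hL := h.bound_pos
  have hω := h.width_pos
  have hI := exteriorKernelIntegral_nonneg n (s * p)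
  have hML : -L ≤ M := by linarith [h.lower, h.width]
  have hle (x : E n) : |(u x - M)⁺| ≤ |u x| + |L| := by
    rw [abs_of_nonneg (posPart_nonneg _), abs_of_pos hL]
    exact sup_le (by linarith [le_abs_self (u x)]) (by positivity)
  calc tailIntegral s p (fun x => (u x - M)⁺) x₀ R
      ≤ ENNReal.ofReal (2 ^ (p - 1)) *
          (tailIntegral s p u x₀ R + tailIntegral s p (fun _ => L) x₀ R) :=
        tailIntegral_le_add hp hum hle x₀ R
    _ ≤ ENNReal.ofReal (2 ^ (p - 1)) * (ENNReal.ofReal (L ^ (p - 1) * R ^ (-(s * p)))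
          + ENNReal.ofReal (L ^ (p - 1) * exteriorKernelIntegral n (s * p) * R ^ (-(s * p)))) := by
        rw [tailIntegral_const hs (by linarith) hL.le x₀ hR]
        gcongr
    _ = ENNReal.ofReal
          (2 ^ p * (1 + exteriorKernelIntegral n (s * p)) * L ^ (p - 1) / R ^ (s * p) / 2) := by
        rw [← ENNReal.ofReal_add (by positivity) (by positivity),
          ← ENNReal.ofReal_mul (by positivity), Real.rpow_sub_one two_ne_zero, Real.rpow_neg hR.le]
        congr 1
        ring
    _ ≤ ENNReal.ofReal ((δ * ω) ^ (p - 1) * ρ ^ (-(s * p)) / 2) := by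
        gcongr
        rw [Real.rpow_neg hρ.le, ← div_eq_mul_inv, div_le_div_iff₀ (by positivity) (by positivity)]
        exact h.tail_small

theorem tailIntegral_radius_le (hs : 0 < s) (hp : 1 ≤ p) (hα : 0 ≤ α) (hδ : 0 ≤ δ)
    (hum : Measurable u) (h : OscillationBound s p α δ L R u x₀ ω ρ m M)
    (hα' : ∫⁻ y in (ball (0 : E n) 1)ᶜ,
        ENNReal.ofReal (((4 * ‖y‖) ^ α - 1) ^ (p - 1) / ‖y‖ ^ ((n : ℝ) + s * p))
      ≤ ENNReal.ofReal (δ ^ (p - 1) / 2))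
    (htail : tailIntegral s p u x₀ R ≤ ENNReal.ofReal (L ^ (p - 1) * R ^ (-(s * p)))) :
    tailIntegral s p (fun x => (u x - M)⁺) x₀ ρ
      ≤ ENNReal.ofReal ((δ * ω) ^ (p - 1) * ρ ^ (-(s * p))) := by
  have hρ := h.radius_pos
  have hω := h.width_pos
  have hcover : (ball x₀ ρ)ᶜ ⊆ ball x₀ R ∩ (ball x₀ ρ)ᶜ ∪ (ball x₀ R)ᶜ := fun x hx =>
    (em (x ∈ ball x₀ R)).imp_left fun hxR => ⟨hxR, hx⟩
  calc tailIntegral s p (fun x => (u x - M)⁺) x₀ ρ ≤ _ := lintegral_mono_set hcover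
    _ ≤ _ := lintegral_union_le _ _ _
    _ ≤ _ := add_le_add (h.setLIntegral_annulus_le hp hα hδ hα')
        (h.tailIntegral_outer_radius_le hs hp hum htail)
    _ = _ := by rw [← ENNReal.ofReal_add (by positivity) (by positivity), add_halves]

theorem datum_le (hlam : 0 ≤ lam) (hd : 0 ≤ d)
    (h : OscillationBound s p α δ L R u x₀ ω ρ m M) (hdL : R ^ (lam + s * p) * d ^ p ≤ L ^ p) :
    ρ ^ (lam + s * p) * d ^ p ≤ (δ * ω) ^ p := by
  have hρ := h.radius_pos
  have hR := h.outer_radius_pos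
  refine le_of_mul_le_mul_right ?_ (by positivity : 0 < R ^ (s * p))
  calc ρ ^ (lam + s * p) * d ^ p * R ^ (s * p)
      = ρ ^ lam * d ^ p * (ρ ^ (s * p) * R ^ (s * p)) := by
        rw [Real.rpow_add hρ]
        ring
    _ ≤ R ^ lam * d ^ p * (ρ ^ (s * p) * R ^ (s * p)) := by
        gcongr
        exact h.radius_le
    _ = R ^ (lam + s * p) * d ^ p * ρ ^ (s * p) := by
        rw [Real.rpow_add hR]
        ring
    _ ≤ L ^ p * ρ ^ (s * p) := by gcongr
    _ ≤ (δ * ω) ^ p * R ^ (s * p) := h.datum_small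

theorem of_ae_abs_le {κ : ℝ} (hp : 1 ≤ p) (hα : 0 ≤ α) (hδ : 0 ≤ δ) (hκ : 0 < κ) (hκ1 : κ ≤ 1)
    (hκδ : κ ^ (s * p) ≤ δ ^ p)
    (hκI : κ ^ (s * p) * (2 ^ p * (1 + exteriorKernelIntegral n (s * p))) ≤ δ ^ (p - 1))
    (hL : 0 < L) (hR : 0 < R) (hu : ∀ᵐ x ∂volume.restrict (ball x₀ R), |u x| ≤ L) :
    OscillationBound s p α δ L R u x₀ (2 * L) (κ * R) (-L) L := by
  have hκR : κ * R ≤ R := mul_le_of_le_one_left hR.le hκ1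
  have hκR0 : 0 < κ * R := by positivity
  refine ⟨hκR0, hκR, by positivity, le_rfl, le_rfl, by ring, ?_, ?_, ?_, ?_⟩
  · filter_upwards [ae_restrict_of_ae_restrict_of_subset (ball_subset_ball hκR) hu] with x hx
    exact abs_le.1 hx
  · filter_upwards [hu] with x hx hxρ
    have hone := one_le_four_mul_div_rpow hα hκR0 (by linarith : κ * R / 4 ≤ ‖x - x₀‖)
    have hprofile := mul_nonneg (by positivity : 0 ≤ 2 * L) (sub_nonneg.2 hone)
    constructor <;> linarith [(abs_le.1 hx).1, (abs_le.1 hx).2]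
  · rw [Real.mul_rpow hκ.le hR.le, Real.mul_rpow hδ (by positivity)]
    calc L ^ p * (κ ^ (s * p) * R ^ (s * p)) = κ ^ (s * p) * L ^ p * R ^ (s * p) := by ring
      _ ≤ δ ^ p * (2 * L) ^ p * R ^ (s * p) := by
          gcongr
          linarith
  · rw [Real.mul_rpow hκ.le hR.le, Real.mul_rpow hδ (by positivity)]
    calc 2 ^ p * (1 + exteriorKernelIntegral n (s * p)) * L ^ (p - 1)
          * (κ ^ (s * p) * R ^ (s * p))
        = κ ^ (s * p) * (2 ^ p * (1 + exteriorKernelIntegral n (s * p))) * L ^ (p - 1)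
          * R ^ (s * p) := by ring
      _ ≤ δ ^ (p - 1) * (2 * L) ^ (p - 1) * R ^ (s * p) := by
          gcongr
          linarith

end OscillationBound

theorem half_volume_le_or (u : E n → ℝ) (x₀ : E n) {r : ℝ} (hr : 0 < r) (a : ℝ) :
    ENNReal.ofReal (unitBallVolume n * r ^ n / 2) ≤ volume ({x | u x ≤ a} ∩ ball x₀ r) ∨
      ENNReal.ofReal (unitBallVolume n * r ^ n / 2) ≤ volume ({x | -u x ≤ -a} ∩ ball x₀ r) := by
  by_contra! hsmall
  have hV := unitBallVolume_pos n
  have hcover : ball x₀ r ⊆ {x | u x ≤ a} ∩ ball x₀ r ∪ {x | -u x ≤ -a} ∩ ball x₀ r := fun x hx =>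
    (le_total (u x) a).imp (fun h => ⟨h, hx⟩) fun h => ⟨neg_le_neg h, hx⟩
  have hlt := ((measure_mono hcover).trans (measure_union_le _ _)).trans_lt
    (ENNReal.add_lt_add hsmall.1 hsmall.2)
  rw [volume_ball_eq x₀ hr, ← ENNReal.ofReal_add (by positivity) (by positivity),
    add_halves] at hlt
  exact hlt.false

theorem exists_decay_exponent {δ : ℝ} (hs : 0 < s) (hp : 1 < p) (hδ : 0 < δ) (n : ℕ) :
    ∃ α : ℝ, 0 < α ∧ α < s ∧ 1 - 4 ^ (-α) ≤ δ / 2 ∧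
      ∫⁻ y in (ball (0 : E n) 1)ᶜ,
        ENNReal.ofReal (((4 * ‖y‖) ^ α - 1) ^ (p - 1) / ‖y‖ ^ ((n : ℝ) + s * p))
      ≤ ENNReal.ofReal (δ ^ (p - 1) / 2) := by
  have hfin : Module.finrank ℝ (E n) < (n : ℝ) + s * p := by
    rw [finrank_euclideanSpace_fin]
    exact lt_add_of_pos_right _ (by positivity)
  have hdrop : Filter.Tendsto (fun α : ℝ => 1 - (4 : ℝ) ^ (-α)) (nhds 0) (nhds 0) :=
    Continuous.tendsto' (continuous_const.sub <|
      (Real.continuous_const_rpow four_ne_zero).comp continuous_neg) _ _ (by simp)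
  exact (eventually_mem_nhdsWithin.and <|
    ((eventually_lt_nhds hs).filter_mono nhdsWithin_le_nhds).and <|
    ((hdrop.eventually_le_const (half_pos hδ)).filter_mono nhdsWithin_le_nhds).and <|
    (tendsto_setLIntegral_rpow_sub_one volume (sub_pos.2 hp) hfin).eventually_le_const
      (by positivity)).exists

theorem exists_initial_radius_ratio {δ : ℝ} (hs : 0 < s) (hp : 0 < p) (hδ : 0 < δ) (n : ℕ) :
    ∃ κ : ℝ, 0 < κ ∧ κ ≤ 1 ∧ κ ^ (s * p) ≤ δ ^ p ∧
      κ ^ (s * p) * (2 ^ p * (1 + exteriorKernelIntegral n (s * p))) ≤ δ ^ (p - 1) := by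
  have hsp : 0 < s * p := by positivity
  have hzero : Filter.Tendsto (fun κ : ℝ => κ ^ (s * p)) (nhdsWithin 0 (Ioi 0)) (nhds 0) :=
    (Continuous.tendsto' (Real.continuous_rpow_const hsp.le) _ _
      (Real.zero_rpow hsp.ne')).mono_left nhdsWithin_le_nhds
  have hzero' := hzero.mul_const (2 ^ p * (1 + exteriorKernelIntegral n (s * p)))
  rw [zero_mul] at hzero'
  exact (eventually_mem_nhdsWithin.and <|
    ((eventually_le_nhds one_pos).filter_mono nhdsWithin_le_nhds).and <|
    (hzero.eventually_le_const (by positivity)).and <|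
    hzero'.eventually_le_const (by positivity)).exists

theorem exists_shrink_upper (hs : 0 < s) (hs1 : s ≤ 1) (hp : 1 < p) (hH : 0 < H) (hlam : 0 ≤ lam)
    (n : ℕ) :
    ∃ α δ : ℝ, 0 < α ∧ α < s ∧ 0 < δ ∧ ∀ d : ℝ, 0 ≤ d → ∀ f : E n → ℝ, Measurable f →
      ∀ (x₀ : E n) (R L : ℝ), SuperlevelCaccioppoli s p d H lam f x₀ R →
      R ^ (lam + s * p) * d ^ p ≤ L ^ p →
      tailIntegral s p f x₀ R ≤ ENNReal.ofReal (L ^ (p - 1) * R ^ (-(s * p))) →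
      ∀ ω ρ m M, OscillationBound s p α δ L R f x₀ ω ρ m M →
      ENNReal.ofReal (unitBallVolume n * (ρ / 2) ^ n / 2)
        ≤ volume ({x | f x ≤ M - ω / 2} ∩ ball x₀ (ρ / 2)) →
      OscillationBound s p α δ L R f x₀ (4 ^ (-α) * ω) (ρ / 4) m (M - (1 - 4 ^ (-α)) * ω) := by
  obtain ⟨δ, hδ, -, hgrowth⟩ := exists_ae_le_sub_of_half_volume_le hs hs1 hp hH hlam n
  obtain ⟨α, hα, hαs, hαδ, hα'⟩ := exists_decay_exponent hs hp hδ n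
  refine ⟨α, δ, hα, hαs, hδ, fun d hd f hfm x₀ R L hf hdL htail ω ρ m M h hlow =>
    h.shrink_upper hp.le hα.le hαs.le hδ.le ?_⟩
  have hω := h.width_pos
  have hupper := hgrowth d hd f hfm x₀ ρ h.radius_pos (hf.mono h.radius_le) M ω hω
    (h.near.mono fun x hx => hx.2) hlow (h.datum_le hlam hd hdL)
    (h.tailIntegral_radius_le hs hp.le hα.le hδ.le hfm hα' htail)
  filter_upwards [hupper] with x hx
  have : (1 - (4 : ℝ) ^ (-α)) * ω ≤ δ / 2 * ω := by gcongr
  linarith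

theorem exists_oscillationBound_iter (hs : 0 < s) (hs1 : s ≤ 1) (hp : 1 < p) (hH : 0 < H)
    (hlam : 0 ≤ lam) (n : ℕ) :
    ∃ α δ κ : ℝ, 0 < α ∧ α < s ∧ 0 < κ ∧ κ ≤ 1 ∧ ∀ d : ℝ, 0 ≤ d → ∀ u : E n → ℝ,
      Measurable u → ∀ (x₀ : E n) (R : ℝ), 0 < R → SuperlevelCaccioppoli s p d H lam u x₀ R →
      SuperlevelCaccioppoli s p d H lam (fun x => -u x) x₀ R → ∀ L : ℝ, 0 < L →
      (∀ᵐ x ∂volume.restrict (ball x₀ R), |u x| ≤ L) →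
      R ^ (lam + s * p) * d ^ p ≤ L ^ p →
      tailIntegral s p u x₀ R ≤ ENNReal.ofReal (L ^ (p - 1) * R ^ (-(s * p))) → ∀ j : ℕ,
      ∃ m M, OscillationBound s p α δ L R u x₀ ((4 ^ (-α)) ^ j * (2 * L)) (κ * R / 4 ^ j) m M := by
  obtain ⟨α, δ, hα, hαs, hδ, hshrink⟩ := exists_shrink_upper hs hs1 hp hH hlam n
  obtain ⟨κ, hκ, hκ1, hκδ, hκI⟩ := exists_initial_radius_ratio hs (zero_lt_one.trans hp) hδ n
  refine ⟨α, δ, κ, hα, hαs, hκ, hκ1, fun d hd u hum x₀ R hR hcu hcneg L hL hu hdL htail j => ?_⟩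
  have htail_neg : tailIntegral s p (fun x => -u x) x₀ R
      ≤ ENNReal.ofReal (L ^ (p - 1) * R ^ (-(s * p))) :=
    (tailIntegral_mono hp.le (fun x => (abs_neg _).le) x₀ le_rfl).trans htail
  induction j with
  | zero => exact ⟨-L, L, by
      simpa using OscillationBound.of_ae_abs_le hp.le hα.le hδ.le hκ hκ1 hκδ hκI hL hR hu⟩
  | succ j ih =>
    obtain ⟨m, M, h⟩ := ih
    rw [pow_succ', pow_succ, mul_assoc, ← div_div]
    set ω : ℝ := (4 ^ (-α)) ^ j * (2 * L)
    rcases half_volume_le_or u x₀ (half_pos h.radius_pos) (M - ω / 2) with hlow | hlow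
    · exact ⟨_, _, hshrink d hd u hum x₀ R L hcu hdL htail _ _ _ _ h hlow⟩
    · rw [show -(M - ω / 2) = -m - ω / 2 by linarith [h.width]] at hlow
      have hneg :=
        (hshrink d hd (fun x => -u x) hum.neg x₀ R L hcneg hdL htail_neg _ _ _ _ h.neg hlow).neg
      simp only [neg_neg] at hneg
      exact ⟨_, _, hneg⟩

/-! ### From oscillation decay to Hölder continuity -/

theorem ball_infDist_frontier_subset {X : Type*} [NormedAddCommGroup X] [NormedSpace ℝ X]
    [FiniteDimensional ℝ X] {Ω : Set X} {x₀ : X} (hx₀ : x₀ ∈ Ω) :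
    ball x₀ (infDist x₀ (frontier Ω)) ⊆ Ω := by
  rcases eq_or_ne Ω univ with rfl | hΩ
  · exact subset_univ _
  · obtain ⟨y, hy, hdist⟩ := exists_mem_frontier_infDist_compl_eq_dist hx₀ hΩ
    exact (ball_subset_ball ((infDist_le_dist_of_mem hy).trans_eq hdist.symm)).trans
      ball_infDist_compl_subset

theorem infDist_frontier_pos {X : Type*} [PseudoMetricSpace X] [PreconnectedSpace X] {Ω : Set X}
    (hΩ : IsOpen Ω) (hne : Ω ≠ univ) {x₀ : X} (hx₀ : x₀ ∈ Ω) : 0 < infDist x₀ (frontier Ω) :=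
  (isClosed_frontier.notMem_iff_infDist_pos (nonempty_frontier_iff.2 ⟨⟨x₀, hx₀⟩, hne⟩)).1
    fun h => (hΩ.frontier_eq ▸ h).2 hx₀

theorem lt_infDist_of_mem_ball {X : Type*} [PseudoMetricSpace X] {S : Set X} {x₀ x : X} {R : ℝ}
    (hR : R < infDist x₀ S / 2) (hx : x ∈ ball x₀ R) : R < infDist x S := by
  have := infDist_le_infDist_add_dist (s := S) (x := x₀) (y := x)
  rw [dist_comm] at this
  linarith [mem_ball.1 hx]

theorem eventually_closedBall_one_div_subset {X : Type*} [PseudoMetricSpace X] {U : Set X}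
    (hU : IsOpen U) {x : X} (hx : x ∈ U) :
    ∀ᶠ i : ℕ in Filter.atTop, closedBall x (1 / ((i : ℝ) + 1)) ⊆ U := by
  obtain ⟨ε, hε, hεU⟩ := Metric.isOpen_iff.1 hU x hx
  filter_upwards [(tendsto_one_div_add_atTop_nhds_zero_nat (𝕜 := ℝ)).eventually_lt_const hε]
    with i hi
  exact (closedBall_subset_ball hi).trans hεU

section PreciseRepresentative

variable {X : Type*} [MetricSpace X] [MeasurableSpace X] {μ : Measure X} {w w' : X → ℝ}

/-- The representative of `w` given by the upper limit of its averages on small balls; it depends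
only on the class of `w` modulo `μ`-null sets. It is the junk value `0` where the averages are
unbounded above. -/
def preciseRep (μ : Measure X) (w : X → ℝ) (x : X) : ℝ :=
  Filter.limsup (fun i : ℕ => ⨍ y in closedBall x (1 / ((i : ℝ) + 1)), w y ∂μ) Filter.atTop

theorem preciseRep_eq_of_eqOn [OpensMeasurableSpace X] {U : Set X} (hU : IsOpen U)
    (h : EqOn w w' U) {x : X} (hx : x ∈ U) : preciseRep μ w x = preciseRep μ w' x := by
  refine Filter.limsup_congr ?_
  filter_upwards [eventually_closedBall_one_div_subset hU hx] with i hi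
  exact setAverage_congr_fun measurableSet_closedBall (.of_forall fun y hy => h (hi hy))

theorem preciseRep_ae_eq [SecondCountableTopology X] [BorelSpace X] [IsUnifLocDoublingMeasure μ]
    [IsLocallyFiniteMeasure μ] (hw : LocallyIntegrable w μ) : preciseRep μ w =ᵐ[μ] w := by
  filter_upwards [IsUnifLocDoublingMeasure.ae_tendsto_average μ hw 1] with x hx
  refine (hx (fun _ => x) (fun i : ℕ => 1 / ((i : ℝ) + 1)) (l := Filter.atTop) ?_ ?_).limsup_eq
  · exact tendsto_nhdsWithin_iff.2 ⟨tendsto_one_div_add_atTop_nhds_zero_nat,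
      .of_forall fun i => mem_Ioi.2 (by positivity)⟩
  · exact .of_forall fun i => mem_closedBall_self (by positivity)

theorem preciseRep_ae_eq_restrict [SecondCountableTopology X] [BorelSpace X]
    [IsUnifLocDoublingMeasure μ] [IsLocallyFiniteMeasure μ] {Ω : Set X} (hΩ : IsOpen Ω)
    (hw : LocallyIntegrable (Ω.indicator w) μ) : preciseRep μ w =ᵐ[μ.restrict Ω] w := by
  filter_upwards [ae_restrict_of_ae (preciseRep_ae_eq hw), ae_restrict_mem hΩ.measurableSet]
    with x hx hxΩ
  rw [preciseRep_eq_of_eqOn hΩ (fun y hy => (indicator_of_mem hy w).symm) hxΩ, hx,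
    indicator_of_mem hxΩ]

theorem preciseRep_mem_Icc [ProperSpace X] [IsFiniteMeasureOnCompacts μ] [μ.IsOpenPosMeasure]
    (hw : AEStronglyMeasurable w μ) {x : X} {U : Set X} (hU : IsOpen U) (hx : x ∈ U) {m M : ℝ}
    (h : ∀ᵐ y ∂μ.restrict U, m ≤ w y ∧ w y ≤ M) : preciseRep μ w x ∈ Icc m M := by
  have hmem : ∀ᶠ i : ℕ in Filter.atTop,
      (⨍ y in closedBall x (1 / ((i : ℝ) + 1)), w y ∂μ) ∈ Icc m M := by
    filter_upwards [eventually_closedBall_one_div_subset hU hx] with i hi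
    have hbounds := ae_restrict_of_ae_restrict_of_subset hi h
    have hfin : μ (closedBall x (1 / ((i : ℝ) + 1))) ≠ ∞ := measure_closedBall_lt_top.ne
    exact (convex_Icc m M).set_average_mem isClosed_Icc
      (measure_closedBall_pos μ x (by positivity)).ne' hfin hbounds
      (Measure.integrableOn_of_bounded hfin hw
        (hbounds.mono fun y hy => abs_le_max_abs_abs hy.1 hy.2))
  have hle := hmem.mono fun i hi => hi.2
  have hge := hmem.mono fun i hi => hi.1
  exact ⟨Filter.le_limsup_of_frequently_le hge.frequently
      (Filter.isBoundedUnder_of_eventually_le hle),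
    Filter.limsup_le_of_le (Filter.isBoundedUnder_of_eventually_ge hge).isCoboundedUnder_le hle⟩

theorem exists_four_rpow_neg_pow_le {α t : ℝ} (hα : 0 ≤ α) (ht : 0 < t) (ht1 : t < 1 / 2) :
    ∃ j : ℕ, t < 1 / 4 ^ j ∧ ((4 : ℝ) ^ (-α)) ^ j ≤ (8 * t) ^ α := by
  obtain ⟨j, hlow, hupp⟩ := exists_nat_pow_near_of_lt_one (x := 2 * t) (y := 1 / 4)
    (by positivity) (by linarith) (by norm_num) (by norm_num)
  rw [pow_succ] at hlow
  rw [one_div_pow] at hlow hupp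
  refine ⟨j, by linarith, ?_⟩
  calc ((4 : ℝ) ^ (-α)) ^ j = (1 / 4 ^ j) ^ α := by
        rw [Real.rpow_neg (by norm_num), ← Real.inv_rpow (by norm_num),
          Real.rpow_pow_comm (by norm_num), inv_pow, one_div]
    _ ≤ (8 * t) ^ α := by
        gcongr
        linarith

theorem abs_preciseRep_sub_le [ProperSpace X] [IsFiniteMeasureOnCompacts μ] [μ.IsOpenPosMeasure]
    (hw : AEStronglyMeasurable w μ) {α r W : ℝ} (hα : 0 ≤ α) (hr : 0 < r) {x y : X}
    (hosc : ∀ j : ℕ, ∃ m M, M - m = (4 ^ (-α)) ^ j * W ∧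
      ∀ᵐ z ∂μ.restrict (ball x (r / 4 ^ j)), m ≤ w z ∧ w z ≤ M)
    (hxy : |preciseRep μ w x - preciseRep μ w y| ≤ W) :
    |preciseRep μ w x - preciseRep μ w y| ≤ W * (8 * (dist x y / r)) ^ α := by
  have hW : 0 ≤ W := (abs_nonneg _).trans hxy
  rcases eq_or_ne x y with rfl | hne
  · rw [sub_self, abs_zero]
    positivity
  have hdist := dist_pos.2 hne
  rcases le_or_gt (1 / 2) (dist x y / r) with hfar | hnear
  · exact hxy.trans (le_mul_of_one_le_right hW (Real.one_le_rpow (by linarith) hα))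
  · obtain ⟨j, hj, hdecay⟩ := exists_four_rpow_neg_pow_le hα (by positivity) hnear
    obtain ⟨m, M, hwidth, hbounds⟩ := hosc j
    rw [div_lt_iff₀ hr, one_div_mul_eq_div] at hj
    have hx := preciseRep_mem_Icc hw isOpen_ball (mem_ball_self (by positivity)) hbounds
    have hy := preciseRep_mem_Icc hw isOpen_ball (mem_ball'.2 hj) hbounds
    calc |preciseRep μ w x - preciseRep μ w y| ≤ M - m :=
          abs_sub_le_of_le_of_le hx.1 hx.2 hy.1 hy.2
      _ = W * (4 ^ (-α)) ^ j := by rw [hwidth, mul_comm]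
      _ ≤ W * (8 * (dist x y / r)) ^ α := by gcongr

end PreciseRepresentative

theorem ofReal_div_le_holderSeminorm {α : ℝ} {v : E n → ℝ} {S : Set (E n)} {x y : E n} (hx : x ∈ S)
    (hy : y ∈ S) : ENNReal.ofReal (|v x - v y| / ‖x - y‖ ^ α) ≤ holderSeminorm α v S :=
  le_iSup₂_of_le x hx (le_iSup₂_of_le y hy le_rfl)

theorem continuousOn_of_holderSeminorm_lt_top {α : ℝ} (hα : 0 < α) {v : E n → ℝ} {S : Set (E n)}
    (h : holderSeminorm α v S < ∞) : ContinuousOn v S := by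
  lift α to NNReal using hα.le
  refine HolderOnWith.continuousOn (C := (holderSeminorm α v S).toNNReal) (r := α)
    (fun x hx y hy => ?_) (by exact_mod_cast hα)
  rcases eq_or_ne x y with rfl | hne
  · simp
  have hdist : 0 < ‖x - y‖ := norm_sub_pos_iff.2 hne
  have hquot := ofReal_div_le_holderSeminorm (α := α) (v := v) hx hy
  rw [ENNReal.coe_toNNReal h.ne, edist_dist, edist_dist, Real.dist_eq, dist_eq_norm,
    ENNReal.ofReal_rpow_of_pos hdist]
  rwa [ENNReal.ofReal_div_of_pos (by positivity),
    ENNReal.div_le_iff (by positivity) ENNReal.ofReal_ne_top] at hquot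

theorem locHolder_of_ball {α : ℝ} (hα : 0 < α) {v : E n → ℝ} {Ω : Set (E n)}
    (h : ∀ x ∈ Ω, ∃ R, 0 < R ∧ holderSeminorm α v (ball x R) < ∞) : LocHolder α v Ω := by
  intro K hKΩ hK
  choose! R hR hfin using h
  have hcont : ContinuousOn v Ω := fun x hx =>
    ((continuousOn_of_holderSeminorm_lt_top hα (hfin x hx)).continuousAt
      (ball_mem_nhds x (hR x hx))).continuousWithinAt
  obtain ⟨b, hb⟩ := hK.exists_bound_of_continuousOn (hcont.mono hKΩ)
  obtain ⟨t, htK, hcover⟩ := hK.elim_nhds_subcover (fun x => ball x (R x))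
    fun x hx => ball_mem_nhds x (hR x (hKΩ hx))
  obtain ⟨δ, hδ, hlebesgue⟩ := lebesgue_number_lemma_of_metric (ι := t)
    (c := fun i => ball (i : E n) (R i)) hK (fun i => isOpen_ball)
    (by simpa only [iUnion_subtype] using hcover)
  have hsum : ∑ x ∈ t, holderSeminorm α v (ball x (R x)) < ∞ :=
    ENNReal.sum_lt_top.2 fun x hx => hfin x (hKΩ (htK x hx))
  refine lt_of_le_of_lt (iSup₂_le fun x hx => iSup₂_le fun y hy => ?_)
    (ENNReal.add_lt_top.2 ⟨hsum, ENNReal.ofReal_lt_top (r := 2 * b / δ ^ α)⟩)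
  rcases lt_or_ge ‖x - y‖ δ with hxy | hxy
  · obtain ⟨i, hi⟩ := hlebesgue x hx
    have hy' : y ∈ ball x δ := by rwa [mem_ball', dist_eq_norm]
    exact (ofReal_div_le_holderSeminorm (hi (mem_ball_self hδ)) (hi hy')).trans <|
      (Finset.single_le_sum_of_canonicallyOrdered
        (f := fun x => holderSeminorm α v (ball x (R x))) i.2).trans le_self_add
  · refine (ENNReal.ofReal_le_ofReal ?_).trans le_add_self
    have hdiff : |v x - v y| ≤ 2 * b :=
      (norm_sub_le (v x) (v y)).trans (by linarith [hb x hx, hb y hy])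
    gcongr
    exact (abs_nonneg _).trans hdiff

theorem setLIntegral_compl_ball_le_tailIntegral (hs : 0 ≤ s) (hp : 0 ≤ p) (u : E n → ℝ)
    {x₀ x : E n} {R : ℝ} (hx : x ∈ ball x₀ R) :
    ∫⁻ y in (ball x₀ (2 * R))ᶜ, ENNReal.ofReal (|u y| ^ (p - 1) / ‖y - x‖ ^ ((n : ℝ) + s * p))
      ≤ ENNReal.ofReal (2 ^ ((n : ℝ) + s * p)) * tailIntegral s p u x₀ (2 * R) := by
  rw [tailIntegral, ← lintegral_const_mul' _ _ ENNReal.ofReal_ne_top]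
  refine setLIntegral_mono' measurableSet_ball.compl fun y hy => ?_
  have hyx₀ : 2 * R ≤ ‖y - x₀‖ := by simpa [dist_eq_norm] using hy
  have hxx₀ : ‖x - x₀‖ < R := mem_ball_iff_norm.1 hx
  have htri : ‖y - x₀‖ ≤ ‖y - x‖ + ‖x - x₀‖ := norm_sub_le_norm_sub_add_norm_sub y x x₀
  have hR : 0 < R := (norm_nonneg _).trans_lt hxx₀
  have hyx₀_pos : 0 < ‖y - x₀‖ := by linarith
  have hyx_pos : 0 < ‖y - x‖ := by linarith
  rw [← ENNReal.ofReal_mul (by positivity), ← mul_div_assoc]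
  refine ENNReal.ofReal_le_ofReal ?_
  rw [div_le_div_iff₀ (by positivity) (by positivity)]
  calc |u y| ^ (p - 1) * ‖y - x₀‖ ^ ((n : ℝ) + s * p)
      ≤ |u y| ^ (p - 1) * (2 * ‖y - x‖) ^ ((n : ℝ) + s * p) := by
        gcongr
        linarith
    _ = 2 ^ ((n : ℝ) + s * p) * |u y| ^ (p - 1) * ‖y - x‖ ^ ((n : ℝ) + s * p) := by
        rw [Real.mul_rpow zero_le_two hyx_pos.le]
        ring

theorem tailIntegral_le_of_center_mem (hs : 0 < s) (hp : 1 ≤ p) {u : E n → ℝ} {x₀ x : E n}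
    {R N : ℝ} (hN : 0 ≤ N) (hx : x ∈ ball x₀ R)
    (hu : ∀ᵐ y ∂volume.restrict (ball x₀ (2 * R)), |u y| ≤ N)
    (htail : tailIntegral s p u x₀ (2 * R) ≤ ENNReal.ofReal (N ^ (p - 1) * R ^ (-(s * p)))) :
    tailIntegral s p u x R ≤ ENNReal.ofReal
      ((exteriorKernelIntegral n (s * p) + 2 ^ ((n : ℝ) + s * p)) * N ^ (p - 1)
        * R ^ (-(s * p))) := by
  have hR : 0 < R := dist_nonneg.trans_lt (mem_ball.1 hx)
  have hI := exteriorKernelIntegral_nonneg n (s * p)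
  have hcover : (ball x R)ᶜ ⊆ ball x₀ (2 * R) ∩ (ball x R)ᶜ ∪ (ball x₀ (2 * R))ᶜ := fun y hy =>
    (em (y ∈ ball x₀ (2 * R))).imp_left fun hy' => ⟨hy', hy⟩
  have hnear : ∫⁻ y in ball x₀ (2 * R) ∩ (ball x R)ᶜ,
      ENNReal.ofReal (|u y| ^ (p - 1) / ‖y - x‖ ^ ((n : ℝ) + s * p))
      ≤ tailIntegral s p (fun _ => N) x R := by
    refine le_trans ?_ (lintegral_mono_set (inter_subset_right (s := ball x₀ (2 * R))))
    refine setLIntegral_mono_ae' (measurableSet_ball.inter measurableSet_ball.compl) ?_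
    filter_upwards [(ae_restrict_iff' measurableSet_ball).1 hu] with y hy hymem
    rw [abs_of_nonneg hN]
    have := Real.rpow_le_rpow (abs_nonneg _) (hy hymem.1) (sub_nonneg.2 hp)
    gcongr
  calc tailIntegral s p u x R
      ≤ ∫⁻ y in ball x₀ (2 * R) ∩ (ball x R)ᶜ ∪ (ball x₀ (2 * R))ᶜ,
          ENNReal.ofReal (|u y| ^ (p - 1) / ‖y - x‖ ^ ((n : ℝ) + s * p)) :=
        lintegral_mono_set hcover
    _ ≤ _ := lintegral_union_le _ _ _
    _ ≤ tailIntegral s p (fun _ => N) x R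
          + ENNReal.ofReal (2 ^ ((n : ℝ) + s * p)) * tailIntegral s p u x₀ (2 * R) :=
        add_le_add hnear (setLIntegral_compl_ball_le_tailIntegral hs.le (by linarith) u hx)
    _ ≤ ENNReal.ofReal (N ^ (p - 1) * exteriorKernelIntegral n (s * p) * R ^ (-(s * p)))
          + ENNReal.ofReal (2 ^ ((n : ℝ) + s * p)) *
            ENNReal.ofReal (N ^ (p - 1) * R ^ (-(s * p))) := by
        rw [tailIntegral_const hs (by linarith) hN x hR]
        gcongr
    _ = _ := by
        rw [← ENNReal.ofReal_mul (by positivity), ← ENNReal.ofReal_add (by positivity)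
          (by positivity)]
        congr 1
        ring

theorem tail_lt_top (hs : 0 ≤ s) (hp : 1 ≤ p) {u : E n → ℝ} (hu : MemWeightedL s p u) (x₀ : E n)
    {R : ℝ} (hR : 0 < R) : tail s p u x₀ R < ∞ :=
  ENNReal.rpow_lt_top_of_nonneg (one_div_nonneg.2 (sub_nonneg.2 hp)) <|
    (ENNReal.mul_lt_top ENNReal.ofReal_lt_top
      (tailIntegral_lt_top hs (by linarith) hu x₀ hR)).ne

theorem tail_congr {u v : E n → ℝ} (h : u =ᵐ[volume] v) (x₀ : E n) (R : ℝ) :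
    tail s p u x₀ R = tail s p v x₀ R :=
  congrArg (fun I => (ENNReal.ofReal (R ^ (s * p)) * I) ^ (1 / (p - 1)))
    (tailIntegral_congr h x₀ R)

theorem tailIntegral_le_of_tail_le (hp : 1 < p) {u : E n → ℝ} {x₀ : E n} {R N : ℝ} (hR : 0 < R)
    (hN : 0 ≤ N) (h : tail s p u x₀ R ≤ ENNReal.ofReal N) :
    tailIntegral s p u x₀ R ≤ ENNReal.ofReal (N ^ (p - 1) * R ^ (-(s * p))) := by
  have hp1 : 0 ≤ p - 1 := by linarith
  have hpow : ENNReal.ofReal (R ^ (s * p)) * tailIntegral s p u x₀ R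
      ≤ ENNReal.ofReal (N ^ (p - 1)) := by
    rw [← tail_rpow hp.ne', ← ENNReal.ofReal_rpow_of_nonneg hN hp1]
    gcongr
  rw [Real.rpow_neg hR.le, ← div_eq_mul_inv, ENNReal.ofReal_div_of_pos (by positivity)]
  exact ENNReal.le_div_iff_mul_le (.inl (by positivity)) (.inl ENNReal.ofReal_ne_top) |>.2 <|
    (mul_comm _ _).trans_le hpow

theorem ae_abs_le_of_eLpNorm_top_le {X : Type*} [MeasurableSpace X] {μ : Measure X} {w : X → ℝ}
    {N : ℝ} (hN : 0 ≤ N) (h : eLpNorm w ∞ μ ≤ ENNReal.ofReal N) : ∀ᵐ x ∂μ, |w x| ≤ N := by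
  rw [eLpNorm_exponent_top] at h
  filter_upwards [ae_le_eLpNormEssSup (f := w) (μ := μ)] with x hx
  rw [Real.enorm_eq_ofReal_abs] at hx
  exact (ENNReal.ofReal_le_ofReal_iff hN).1 (hx.trans h)

theorem exists_one_le_le_rpow {a : ℝ} (ha : 0 < a) (A : ℝ) : ∃ c : ℝ, 1 ≤ c ∧ A ≤ c ^ a := by
  refine ⟨max 1 A ^ a⁻¹, Real.one_le_rpow (le_max_left _ _) (by positivity), ?_⟩
  rw [Real.rpow_inv_rpow (by positivity) ha.ne']
  exact le_max_right _ _

theorem exists_oscillation_decay (hs : 0 < s) (hs1 : s ≤ 1) (hp : 1 < p) (hH : 0 < H)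
    (hlam : 0 ≤ lam) (n : ℕ) :
    ∃ α κ c : ℝ, 0 < α ∧ α < s ∧ 0 < κ ∧ κ ≤ 1 ∧ 1 ≤ c ∧ ∀ d : ℝ, 0 ≤ d → ∀ u : E n → ℝ,
      Measurable u → ∀ (x₀ : E n) (R : ℝ), 0 < R →
      (∀ x ∈ ball x₀ R, SuperlevelCaccioppoli s p d H lam u x R ∧
        SuperlevelCaccioppoli s p d H lam (fun y => -u y) x R) → ∀ N : ℝ, 0 < N →
      (∀ᵐ x ∂volume.restrict (ball x₀ (2 * R)), |u x| ≤ N) →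
      tail s p u x₀ (2 * R) ≤ ENNReal.ofReal N → R ^ ((lam + s * p) / p) * d ≤ N →
      ∀ x ∈ ball x₀ R, ∀ j : ℕ, ∃ m M, M - m = (4 ^ (-α)) ^ j * (2 * (c * N)) ∧
        ∀ᵐ z ∂volume.restrict (ball x (κ * R / 4 ^ j)), m ≤ u z ∧ u z ≤ M := by
  obtain ⟨α, δ, κ, hα, hαs, hκ, hκ1, hiter⟩ := exists_oscillationBound_iter hs hs1 hp hH hlam n
  obtain ⟨c, hc, hcI⟩ := exists_one_le_le_rpow (sub_pos.2 hp)
    (exteriorKernelIntegral n (s * p) + 2 ^ ((n : ℝ) + s * p))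
  refine ⟨α, κ, c, hα, hαs, hκ, hκ1, hc, ?_⟩
  intro d hd u hum x₀ R hR hcacc N hN hu htail hdN x hx j
  have hNL : N ≤ c * N := le_mul_of_one_le_left hN.le hc
  have hux : ∀ᵐ y ∂volume.restrict (ball x R), |u y| ≤ c * N :=
    (ae_restrict_of_ae_restrict_of_subset
      (ball_subset_ball' (by linarith [mem_ball.1 hx])) hu).mono fun y hy => hy.trans hNL
  have hdL : R ^ (lam + s * p) * d ^ p ≤ (c * N) ^ p := by
    have hpow : (R ^ ((lam + s * p) / p) * d) ^ p = R ^ (lam + s * p) * d ^ p := by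
      rw [Real.mul_rpow (by positivity) hd, ← Real.rpow_mul hR.le, div_mul_cancel₀ _ (by linarith)]
    rw [← hpow]
    exact Real.rpow_le_rpow (by positivity) (hdN.trans hNL) (by linarith)
  have htail_center : tailIntegral s p u x₀ (2 * R)
      ≤ ENNReal.ofReal (N ^ (p - 1) * R ^ (-(s * p))) := by
    refine (tailIntegral_le_of_tail_le hp (by positivity) hN.le htail).trans ?_
    have : (2 * R) ^ (-(s * p)) ≤ R ^ (-(s * p)) :=
      Real.rpow_le_rpow_of_nonpos hR (by linarith) (neg_nonpos.2 (by positivity))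
    gcongr
  have htail_x : tailIntegral s p u x R ≤ ENNReal.ofReal ((c * N) ^ (p - 1) * R ^ (-(s * p))) := by
    refine (tailIntegral_le_of_center_mem hs hp.le hN.le hx hu htail_center).trans ?_
    rw [Real.mul_rpow (by linarith) hN.le]
    gcongr
  obtain ⟨m, M, h⟩ := hiter d hd u hum x R hR (hcacc x hx).1 (hcacc x hx).2 (c * N)
    (by positivity) hux hdL htail_x j
  exact ⟨m, M, h.width, h.near⟩

theorem exists_holderSeminorm_preciseRep_le (hs : 0 < s) (hs1 : s ≤ 1) (hp : 1 < p) (hH : 0 < H)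
    (hlam : 0 ≤ lam) (n : ℕ) :
    ∃ α C : ℝ, 0 < α ∧ α < s ∧ 1 ≤ C ∧ ∀ d : ℝ, 0 ≤ d → ∀ u : E n → ℝ,
      Measurable u → ∀ (x₀ : E n) (R : ℝ), 0 < R →
      (∀ x ∈ ball x₀ R, SuperlevelCaccioppoli s p d H lam u x R ∧
        SuperlevelCaccioppoli s p d H lam (fun y => -u y) x R) → ∀ N : ℝ, 0 < N →
      eLpNorm u ∞ (volume.restrict (ball x₀ (2 * R))) + tail s p u x₀ (2 * R)
        + ENNReal.ofReal (R ^ ((lam + s * p) / p) * d) ≤ ENNReal.ofReal N →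
      holderSeminorm α (preciseRep volume u) (ball x₀ R) ≤ ENNReal.ofReal (C / R ^ α * N) := by
  obtain ⟨α, κ, c, hα, hαs, hκ, hκ1, hc, hdecay⟩ := exists_oscillation_decay hs hs1 hp hH hlam n
  have hκα : 1 ≤ (8 / κ) ^ α :=
    Real.one_le_rpow ((one_le_div hκ).2 (by linarith)) hα.le
  refine ⟨α, 2 * c * (8 / κ) ^ α, hα, hαs, one_le_mul_of_one_le_of_one_le (by linarith) hκα,
    fun d hd u hum x₀ R hR hcacc N hN hS => iSup₂_le fun x hx => iSup₂_le fun y hy =>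
      ENNReal.ofReal_le_ofReal ?_⟩
  have hbound := ae_abs_le_of_eLpNorm_top_le hN.le ((le_self_add.trans le_self_add).trans hS)
  have htail := (le_add_self.trans le_self_add).trans hS
  have hdN := (ENNReal.ofReal_le_ofReal_iff hN.le).1 (le_add_self.trans hS)
  have hrep (z : E n) (hz : z ∈ ball x₀ R) : preciseRep volume u z ∈ Icc (-N) N :=
    preciseRep_mem_Icc hum.aestronglyMeasurable isOpen_ball
      (ball_subset_ball (by linarith) hz) (hbound.mono fun _ => abs_le.1)
  have hcrude : |preciseRep volume u x - preciseRep volume u y| ≤ 2 * (c * N) := by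
    have hNL : N ≤ c * N := le_mul_of_one_le_left hN.le hc
    have := abs_sub_le_of_le_of_le (hrep x hx).1 (hrep x hx).2 (hrep y hy).1 (hrep y hy).2
    linarith
  have hholder := abs_preciseRep_sub_le hum.aestronglyMeasurable hα.le (by positivity : 0 < κ * R)
    (hdecay d hd u hum x₀ R hR hcacc N hN hbound htail hdN x hx) hcrude
  refine div_le_of_le_mul₀ (by positivity) (by positivity) (hholder.trans_eq ?_)
  rw [dist_eq_norm, show 8 * (‖x - y‖ / (κ * R)) = 8 / κ * ‖x - y‖ / R by field_simp,
    Real.div_rpow (by positivity) hR.le, Real.mul_rpow (by positivity) (by positivity)]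
  ring

theorem exists_holder_estimate (hs : 0 < s) (hs1 : s ≤ 1) (hp : 1 < p) (hH : 0 < H)
    (hlam : 0 ≤ lam) (n : ℕ) :
    ∃ α C : ℝ, 0 < α ∧ α < s ∧ 1 ≤ C ∧ ∀ d : ℝ, 0 ≤ d → ∀ u : E n → ℝ,
      Measurable u → ∀ (x₀ : E n) (R : ℝ), 0 < R →
      (∀ x ∈ ball x₀ R, SuperlevelCaccioppoli s p d H lam u x R ∧
        SuperlevelCaccioppoli s p d H lam (fun y => -u y) x R) →
      holderSeminorm α (preciseRep volume u) (ball x₀ R) ≤ ENNReal.ofReal (C / R ^ α) *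
        (eLpNorm u ∞ (volume.restrict (ball x₀ (2 * R))) + tail s p u x₀ (2 * R)
          + ENNReal.ofReal (R ^ ((lam + s * p) / p) * d)) := by
  obtain ⟨α, C, hα, hαs, hC, hest⟩ := exists_holderSeminorm_preciseRep_le hs hs1 hp hH hlam n
  refine ⟨α, C, hα, hαs, hC, fun d hd u hum x₀ R hR hcacc => ?_⟩
  have hCR : 0 < C / R ^ α := by positivity
  set S := eLpNorm u ∞ (volume.restrict (ball x₀ (2 * R))) + tail s p u x₀ (2 * R)
    + ENNReal.ofReal (R ^ ((lam + s * p) / p) * d)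
  rcases eq_or_ne S ∞ with hS | hS
  · rw [hS, ENNReal.mul_top (ENNReal.ofReal_pos.2 hCR).ne']
    exact le_top
  have hlim : Filter.Tendsto (fun N => ENNReal.ofReal (C / R ^ α * N))
      (nhdsWithin S.toReal (Ioi S.toReal)) (nhds (ENNReal.ofReal (C / R ^ α) * S)) := by
    rw [← ENNReal.ofReal_toReal hS, ← ENNReal.ofReal_mul hCR.le,
      ENNReal.toReal_ofReal ENNReal.toReal_nonneg]
    exact (ENNReal.continuous_ofReal.comp (continuous_const_mul _)).continuousWithinAt
  refine ge_of_tendsto hlim (eventually_mem_nhdsWithin.mono fun N hN => ?_)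
  have hN0 : 0 < N := ENNReal.toReal_nonneg.trans_lt hN
  exact hest d hd u hum x₀ R hR hcacc N hN0 ((ENNReal.le_ofReal_iff_toReal_le hS hN0.le).2 hN.le)

theorem exists_measurable_ae_eq_of_mem_DG (hp : 1 < p) {Ω : Set (E n)} {u : E n → ℝ}
    (hu : u ∈ DG s p d H lam Ω) :
    ∃ v : E n → ℝ, Measurable v ∧ u =ᵐ[volume] v ∧ ∀ x ∈ Ω, ∀ ρ < infDist x (frontier Ω),
      SuperlevelCaccioppoli s p d H lam v x ρ ∧
        SuperlevelCaccioppoli s p d H lam (fun y => -v y) x ρ := by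
  obtain ⟨v, hv, huv⟩ := hu.1.1.1
  exact ⟨v, hv, huv, fun x hx ρ hρ =>
    ⟨(superlevelCaccioppoli_of_mem_DGPlus hp hu.1 hx hρ).congr huv,
      (superlevelCaccioppoli_neg_of_mem_DGMinus hp hu.2 hx hρ).congr huv.neg⟩⟩

theorem eLpNorm_top_ball_lt_top_of_mem_DG (hs : 0 < s) (hs1 : s ≤ 1) (hp : 1 < p) (hH : 0 < H)
    (hlam : 0 ≤ lam) (hd : 0 ≤ d) {Ω : Set (E n)} {u : E n → ℝ} (hu : u ∈ DG s p d H lam Ω)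
    {x : E n} (hx : x ∈ Ω) {r : ℝ} (hr : 0 < r) (hrΩ : 2 * r < infDist x (frontier Ω)) :
    eLpNorm u ∞ (volume.restrict (ball x r)) < ∞ := by
  obtain ⟨v, hv, huv, hcacc⟩ := exists_measurable_ae_eq_of_mem_DG hp hu
  have hr2 : 2 * r / 2 = r := by ring
  have hLp : ∫⁻ y in ball x (2 * r), ENNReal.ofReal (|v y| ^ p) < ∞ := by
    have hvΩ : MemLp v (ENNReal.ofReal p) (volume.restrict Ω) :=
      hu.1.2.1.1.ae_eq (ae_restrict_of_ae huv)
    refine (lintegral_mono_set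
      ((ball_subset_ball hrΩ.le).trans (ball_infDist_frontier_subset hx))).trans_lt ?_
    rw [← eLpNorm_ofReal_rpow_of_nonneg (by linarith) fun y => abs_nonneg (v y)]
    exact ENNReal.rpow_lt_top_of_nonneg (by linarith) hvΩ.abs.2.ne
  have htail : tailIntegral s p v x (2 * r / 2) < ∞ :=
    tailIntegral_congr huv x _ ▸ tailIntegral_lt_top hs.le (by linarith) hu.1.1 x (by linarith)
  obtain ⟨K₁, hK₁⟩ := (hcacc x hx _ hrΩ).1.exists_ae_le hs hs1 hp hH hlam hd hv (by linarith)
    htail hLp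
  obtain ⟨K₂, hK₂⟩ := (hcacc x hx _ hrΩ).2.exists_ae_le hs hs1 hp hH hlam hd hv.fun_neg
    (by linarith) ((tailIntegral_mono hp.le (fun y => (abs_neg _).le) x le_rfl).trans_lt htail)
    (by simpa only [abs_neg] using hLp)
  rw [hr2] at hK₁ hK₂
  rw [eLpNorm_congr_ae (ae_restrict_of_ae huv)]
  refine eLpNormEssSup_lt_top_of_ae_bound (C := max K₁ K₂) ?_
  filter_upwards [hK₁, hK₂] with y hy₁ hy₂
  exact abs_le'.2 ⟨hy₁.trans (le_max_left _ _), hy₂.trans (le_max_right _ _)⟩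

theorem locallyIntegrable_indicator_of_memLp {q : ℝ≥0∞} (hq : 1 ≤ q) {Ω : Set (E n)}
    (hΩ : IsOpen Ω) {w : E n → ℝ} (hw : MemLp w q (volume.restrict Ω)) :
    LocallyIntegrable (Ω.indicator w) volume :=
  ((memLp_indicator_iff_restrict hΩ.measurableSet).2 hw).locallyIntegrable hq

end

end FracDG

theorem theorem2p3_general (n : ℕ) (s p H lam : ℝ) (hs₀ : 0 < s) (hs₁ : s < 1)
    (hp : 1 < p) (hH : 0 < H) (hlam : 0 ≤ lam) :
    ∃ α C : ℝ, 0 < α ∧ α < 1 ∧ 1 ≤ C ∧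
      ∀ (Ω : Set (FracDG.E n)), IsOpen Ω → Ω ≠ univ →
      ∀ d : ℝ, 0 ≤ d → ∀ u ∈ FracDG.DG s p d H lam Ω,
        ∃ v : FracDG.E n → ℝ, v =ᵐ[volume.restrict Ω] u ∧ FracDG.LocHolder α v Ω ∧
          ∀ x₀ ∈ Ω, ∀ R : ℝ, 0 < R → R < infDist x₀ (frontier Ω) / 2 →
            FracDG.holderSeminorm α v (ball x₀ R) ≤
              ENNReal.ofReal (C / R ^ α) *
                (eLpNorm u ∞ (volume.restrict (ball x₀ (2 * R)))
                  + FracDG.tail s p u x₀ (2 * R)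
                  + ENNReal.ofReal (R ^ ((lam + s * p) / p) * d)) := by
  obtain ⟨α, C, hα, hαs, hC, hest⟩ := FracDG.exists_holder_estimate hs₀ hs₁.le hp hH hlam n
  refine ⟨α, C, hα, hαs.trans hs₁, hC, fun Ω hΩ hne d hd u hu => ?_⟩
  obtain ⟨w, hwm, huw, hcacc⟩ := FracDG.exists_measurable_ae_eq_of_mem_DG hp hu
  have hbound (x₀) (hx₀ : x₀ ∈ Ω) (R : ℝ) (hR : 0 < R) (hRΩ : R < infDist x₀ (frontier Ω) / 2) :=
    hest d hd w hwm x₀ R hR fun x hx => hcacc x (FracDG.ball_infDist_frontier_subset hx₀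
      (ball_subset_ball (by linarith) hx)) R (FracDG.lt_infDist_of_mem_ball hRΩ hx)
  simp_rw [← eLpNorm_congr_ae (ae_restrict_of_ae huw), ← FracDG.tail_congr huw] at hbound
  have hrep : FracDG.preciseRep volume w =ᵐ[volume.restrict Ω] w :=
    FracDG.preciseRep_ae_eq_restrict hΩ <| FracDG.locallyIntegrable_indicator_of_memLp
      (ENNReal.one_le_ofReal.2 hp.le) hΩ (hu.1.2.1.1.ae_eq (ae_restrict_of_ae huw))
  refine ⟨FracDG.preciseRep volume w, hrep.trans (ae_restrict_of_ae huw.symm),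
    FracDG.locHolder_of_ball hα fun x hx => ?_, hbound⟩
  have hD := FracDG.infDist_frontier_pos hΩ hne hx
  set R := infDist x (frontier Ω) / 8
  have hsup : eLpNorm u ∞ (volume.restrict (ball x (2 * R))) < ∞ :=
    FracDG.eLpNorm_top_ball_lt_top_of_mem_DG hs₀ hs₁.le hp hH hlam hd hu hx (by positivity)
      (by simp only [R]; linarith)
  have htail : FracDG.tail s p u x (2 * R) < ∞ :=
    FracDG.tail_lt_top hs₀.le hp.le hu.1.1 x (by positivity)
  exact ⟨R, by positivity, (hbound x hx R (by positivity) (by simp only [R]; linarith)).trans_lt <|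
    ENNReal.mul_lt_top ENNReal.ofReal_lt_top
      (ENNReal.add_lt_top.2 ⟨ENNReal.add_lt_top.2 ⟨hsup, htail⟩, ENNReal.ofReal_lt_top⟩)⟩

theorem theorem2p3 (n : ℕ) (hn : 1 ≤ n) (s p H lam : ℝ) (hs₀ : 0 < s) (hs₁ : s < 1)
    (hp : 1 < p) (hsp : s * p < (n : ℝ)) (hH : 1 ≤ H) (hlam : 0 ≤ lam) :
    ∃ α C : ℝ, 0 < α ∧ α < 1 ∧ 1 ≤ C ∧
      ∀ (Ω : Set (FracDG.E n)), IsOpen Ω → Bornology.IsBounded Ω →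
      ∀ d : ℝ, 0 ≤ d → ∀ u ∈ FracDG.DG s p d H lam Ω,
        ∃ v : FracDG.E n → ℝ, v =ᵐ[volume.restrict Ω] u ∧ FracDG.LocHolder α v Ω ∧
          ∀ x₀ ∈ Ω, ∀ R : ℝ, 0 < R → R < infDist x₀ (frontier Ω) / 2 →
            FracDG.holderSeminorm α v (ball x₀ R) ≤
              ENNReal.ofReal (C / R ^ α) *
                (eLpNorm u ∞ (volume.restrict (ball x₀ (2 * R)))
                  + FracDG.tail s p u x₀ (2 * R)
                  + ENNReal.ofReal (R ^ ((lam + s * p) / p) * d)) := by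
  have : NeZero n := ⟨by lia⟩
  obtain ⟨α, C, hα, hα1, hC, h⟩ := theorem2p3_general n s p H lam hs₀ hs₁ hp (by linarith) hlam
  exact ⟨α, C, hα, hα1, hC, fun Ω hΩ hb => h Ω hΩ fun huniv =>
    NormedSpace.unbounded_univ ℝ (FracDG.E n) (huniv ▸ hb)⟩
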